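/- **Conventions.** For $N\ge 0$ let $NA_1$ be the lattice $\mathbb{Z}^N$ with the bilinear form $(x,y)=2\sum_j x_jy_j$; write $\mathfrak z=(z_1,\dots,z_N)\in NA_1\otimes\mathbb{C}=\mathbb{C}^N$. Let $J_{k,NA_1;1}$ be the space of holomorphic Jacobi forms of weight $k\in\mathbb{Z}$, index $1$ and trivial character, i.e. of holomorphic functions $\varphi:\mathbb{H}\times\mathbb{C}^N\to\mathbb{C}$ such that $$\varphi\Bigl(\tfrac{a\tau+b}{c\tau+d},\tfrac{\mathfrak z}{c\tau+d}\Bigr)=(c\tau+d)^k e^{\pi i\frac{c(\mathfrak z,\mathfrak z)}{c\tau+d}}\varphi(\tau,\mathfrak z),\qquad \varphi(\tau,\mathfrak z+x\tau+y)=e^{-2\pi i(\frac12(x,x)\tau+(x,\mathfrak z))}\varphi(\tau,\mathfrak z)$$ for all $\begin{pmatrix}a&b\\c&d\end{pmatrix}\in \mathrm{SL}(2,\mathbb{Z})$ and $x,y\in NA_1$, and with a Fourier expansion $\varphi=\sum f(n,l)e^{2\pi i(n\tau+(l,\mathfrak z))}$ over $n\in\mathbb{Z}$, $l\in (NA_1)^\vee$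 with $n\ge0$ and $2n-(l,l)\ge 0$ whenever $f(n,l)\ne0$. Such a form is a cusp form if $2n-(l,l)>0$ whenever $f(n,l)\neq 0$. Put $q=e^{2\pi i\tau}$, $\eta=q^{1/24}\prod_{n\ge1}(1-q^n)$, $\Delta_{12}=\eta^{24}$, $\vartheta(\tau,z)=\sum_{n\in\mathbb{Z}}\left(\frac{-4}{n}\right)e^{\pi i n^2\tau/4+\pi i nz}$. Let $e_4,e_6$ be the normalized Eisenstein series for $\mathrm{SL}(2,\mathbb{Z})$ and $e_{4,1},e_{6,1}$ the Jacobi–Eisenstein series of Eichler and Zagier of index $1$, $$e_{k,1}(\tau,z)=\frac12\sum_{\substack{c,d\in\mathbb{Z}\\ \gcd(c,d)=1}}\sum_{\lambda\in\mathbb{Z}}(c\tau+d)^{-k}\exp\Bigl(2\pi i\Bigl(\lambda^2\tfrac{a\tau+b}{c\tau+d}+\tfrac{2\lambda z-cz^2}{c\tau+d}\Bigr)\Bigr),$$ where for each $(c,d)$ integers $a,b$ with $ad-bc=1$ are chosen. Put $\varphi_{12,A_1}=\frac1{144}(e_4^2e_{4,1}-e_6e_{6,1})$ and $\phi_{0,1}=\varphi_{12,A_1}/\eta^{24}$.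 For $1\le N\le 4$ put $$\psi_{12-2N,NA_1}(\tau,\mathfrak z)=\Bigl(\eta(\tau)^{12-3N}\prod_{j=1}^N\vartheta(\tau,z_j)\Bigr)^2 ,$$ and put $\psi_{12,0A_1}=\Delta_{12}$. For a function $\varphi$ on $\mathbb{H}\times\mathbb{C}^N$ put $(\varphi\otimes\phi_{0,1})(\tau,z_1,\dots,z_{N+1})=\varphi(\tau,z_1,\dots,z_N)\,\phi_{0,1}(\tau,z_{N+1})$. For $0\le m\le N\le 4$ let $F_{m,N}$ be the function on $\mathbb{H}\times\mathbb{C}^N$ obtained from $\psi_{12-2m,mA_1}$ by applying $\otimes\phi_{0,1}$ exactly $N-m$ times. **Statement.** 1. $\Delta_{12}$ is a cusp form of weight $12$ for $\mathrm{SL}(2,\mathbb{Z})$, and $F_{0,1}=\varphi_{12,A_1}$. 2. $F_{m,N}\in J_{12-2m,NA_1;1}$ for all $0\le m\le N\le 4$. Thus, with $\varphi_{12-2m,NA_1}:=F_{m,N}$ for $m<N$, there are Jacobi forms $\varphi_{k,NA_1}\in J_{k,NA_1;1}$ and $\psi_{12-2N,NA_1}\in J_{12-2N,NA_1;1}$.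 3. $F_{m,N}$ is a cusp form if $N\le 3$, and is not a cusp form if $N=4$. 4. (Pullbacks.) For $0\le m\le N\le 3$ there is $\alpha\in\mathbb{C}^\times$ with $F_{m,N}(\tau,z_1,\dots,z_N)=\alpha\, F_{m,N+1}(\tau,z_1,\dots,z_N,0)$. 5. (Quasi-pullbacks.) For $1\le N\le 4$ there is $\alpha\in\mathbb{C}^\times$ with $$\psi_{12-2(N-1),(N-1)A_1}(\tau,z_1,\dots,z_{N-1})=\alpha\left.\frac{\partial^2}{\partial z_N^2}\right|_{z_N=0}\psi_{12-2N,NA_1}(\tau,z_1,\dots,z_N).$$ -/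

import Mathlib

open scoped UpperHalfPlane MatrixGroups

noncomputable section

namespace JacobiTower

/-! ### Positive definite even lattices and their duals -/

/-- A positive definite even lattice of rank `N`, given with a `ℤ`-basis: the lattice is `ℤ ^ N`
with the bilinear form whose Gram matrix is `gram`. -/
structure EvenLattice (N : ℕ) where
  gram : Matrix (Fin N) (Fin N) ℤ
  symm : gram.IsSymm
  even : ∀ i, Even (gram i i)
  posDef : (gram.map (fun a : ℤ => (a : ℝ))).PosDef

/-- The bilinear form of the lattice `L`, extended to `L ⊗ R = R ^ N`. -/
def EvenLattice.bil {N : ℕ} (L : EvenLattice N) {R : Type*} [CommRing R]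
    (v w : Fin N → R) : R :=
  ∑ i, ∑ j, v i * (L.gram i j : R) * w j

/-- The dual lattice, as a subset of `L ⊗ ℝ`. -/
def EvenLattice.dual {N : ℕ} (L : EvenLattice N) : Set (Fin N → ℝ) :=
  {l | ∀ x : Fin N → ℤ, ∃ m : ℤ, L.bil l (fun i => (x i : ℝ)) = (m : ℝ)}

/-- The lattice `N A₁`: `ℤ ^ N` with twice the standard scalar product. -/
def NA1 (N : ℕ) : EvenLattice N where
  gram := Matrix.diagonal (fun _ => 2)
  symm := Matrix.diagonal_transpose _
  even := fun i => by simp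
  posDef := by
    rw [Matrix.diagonal_map (by simp)]
    exact Matrix.PosDef.diagonal (fun i => by simp)

/-! ### Jacobi forms of integral weight with trivial character -/

/-- The action of `A ∈ SL(2, ℤ)` of weight `k` and index `t`. -/
def slashSL {N : ℕ} (L : EvenLattice N) (k : ℤ) (t : ℚ) (φ : ℍ → (Fin N → ℂ) → ℂ) (A : SL(2, ℤ))
    (τ : ℍ) (z : Fin N → ℂ) : ℂ :=
  ((A 1 0 : ℂ) * τ + (A 1 1 : ℂ)) ^ (-k) *
    Complex.exp (-(Real.pi * Complex.I * t *
      ((A 1 0 : ℂ) * L.bil z z / ((A 1 0 : ℂ) * τ + (A 1 1 : ℂ))))) *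
    φ (A • τ) (fun i => z i / ((A 1 0 : ℂ) * τ + (A 1 1 : ℂ)))

/-- The action of the Heisenberg element `[x, y : r]` of index `t`. -/
def slashHeis {N : ℕ} (L : EvenLattice N) (t : ℚ) (φ : ℍ → (Fin N → ℂ) → ℂ)
    (x y : Fin N → ℤ) (r : ℚ) (τ : ℍ) (z : Fin N → ℂ) : ℂ :=
  Complex.exp (2 * Real.pi * Complex.I * t *
      (((L.bil x x : ℤ) : ℂ) / 2 * τ + L.bil (fun i => (x i : ℂ)) z +
        ((L.bil x y : ℤ) : ℂ) / 2 + r)) *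
    φ τ (fun i => z i + x i * τ + y i)

/-- `φ` is invariant under the integral Jacobi group `SL(2, ℤ) ⋉ H(L)`, whose Heisenberg part
`H(L)` consists of the `[x, y : r]` with `x, y ∈ L`, `2 r ∈ ℤ` and `r + (x, y) / 2 ∈ ℤ`. -/
def IsJacobiInvariant {N : ℕ} (L : EvenLattice N) (k : ℤ) (t : ℚ)
    (φ : ℍ → (Fin N → ℂ) → ℂ) : Prop :=
  (∀ (A : SL(2, ℤ)) (τ : ℍ) (z : Fin N → ℂ), slashSL L k t φ A τ z = φ τ z) ∧
  ∀ (x y : Fin N → ℤ) (r : ℚ), (∃ a : ℤ, 2 * r = a) →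
    (∃ b : ℤ, r + ((L.bil x y : ℤ) : ℚ) / 2 = b) →
    ∀ (τ : ℍ) (z : Fin N → ℂ), slashHeis L t φ x y r τ z = φ τ z

/-- `φ` is holomorphic on `ℍ × (L ⊗ ℂ)`. -/
def IsHolomorphic {N : ℕ} (φ : ℍ → (Fin N → ℂ) → ℂ) : Prop :=
  DifferentiableOn ℂ (fun p : ℂ × (Fin N → ℂ) => φ (UpperHalfPlane.ofComplex p.1) p.2)
    {p | 0 < p.1.im}

/-- `f` is the family of Fourier coefficients of `φ`:
`φ(τ, z) = ∑ f(n, l) exp(2 π i (n τ + (l, z)))` over `n ∈ ℤ` and `l` in the dual lattice. -/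
def HasFourierExpansion {N : ℕ} (L : EvenLattice N) (φ : ℍ → (Fin N → ℂ) → ℂ)
    (f : ℤ → L.dual → ℂ) : Prop :=
  ∀ (τ : ℍ) (z : Fin N → ℂ),
    HasSum (fun p : ℤ × L.dual => f p.1 p.2 *
      Complex.exp (2 * Real.pi * Complex.I *
        (p.1 * τ + L.bil (fun i => ((p.2 : Fin N → ℝ) i : ℂ)) z))) (φ τ z)

/-- Holomorphic Jacobi forms of weight `k` and index `t` for `L` with trivial character. -/
def IsJacobiForm {N : ℕ} (L : EvenLattice N) (k : ℤ) (t : ℚ)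
    (φ : ℍ → (Fin N → ℂ) → ℂ) : Prop :=
  IsHolomorphic φ ∧ IsJacobiInvariant L k t φ ∧
  ∃ f : ℤ → L.dual → ℂ, HasFourierExpansion L φ f ∧
    ∀ (n : ℤ) (l : L.dual), f n l ≠ 0 →
      0 ≤ n ∧ 0 ≤ 2 * (n : ℝ) * t - L.bil (l : Fin N → ℝ) l

/-- Jacobi cusp forms of weight `k` and index `t` for `L` with trivial character. -/
def IsJacobiCuspForm {N : ℕ} (L : EvenLattice N) (k : ℤ) (t : ℚ)
    (φ : ℍ → (Fin N → ℂ) → ℂ) : Prop :=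
  IsHolomorphic φ ∧ IsJacobiInvariant L k t φ ∧
  ∃ f : ℤ → L.dual → ℂ, HasFourierExpansion L φ f ∧
    ∀ (n : ℤ) (l : L.dual), f n l ≠ 0 →
      0 ≤ n ∧ 0 < 2 * (n : ℝ) * t - L.bil (l : Fin N → ℝ) l

/-! ### The basic functions -/

/-- The Jacobi theta series `ϑ(τ, z) = ∑ (-4 / n) q ^ (n ^ 2 / 8) r ^ (n / 2)`. -/
def theta (τ : ℍ) (z : ℂ) : ℂ :=
  ∑' n : ℤ, ((ZMod.χ₄ (n : ZMod 4) : ℤ) : ℂ) *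
    Complex.exp (Real.pi * Complex.I * (n : ℂ) ^ 2 * τ / 4 + Real.pi * Complex.I * n * z)

/-- The Jacobi-Eisenstein series of Eichler and Zagier of (even) weight `k` and index `1`,
with constant term `1`:
`1/2 ∑_{(c,d)=1} ∑_λ (cτ+d)^(-k) e(λ² (aτ+b)/(cτ+d) + 2λ z/(cτ+d) - c z²/(cτ+d))`,
where for each coprime pair `(c, d)` integers `a, b` with `a d - b c = 1` are chosen;
here `a = Int.gcdB c d` and `b = -Int.gcdA c d` (the value does not depend on the choice). -/
def jacobiEisenstein (k : ℕ) (τ : ℍ) (z : ℂ) : ℂ :=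
  1 / 2 * ∑' p : {p : ℤ × ℤ // IsCoprime p.1 p.2}, ∑' m : ℤ,
    ((p.1.1 : ℂ) * τ + p.1.2) ^ (-(k : ℤ)) *
      Complex.exp (2 * Real.pi * Complex.I *
        ((m : ℂ) ^ 2 * (((Int.gcdB p.1.1 p.1.2 : ℤ) : ℂ) * τ - ((Int.gcdA p.1.1 p.1.2 : ℤ) : ℂ)) /
            ((p.1.1 : ℂ) * τ + p.1.2)
          + 2 * m * z / ((p.1.1 : ℂ) * τ + p.1.2)
          - (p.1.1 : ℂ) * z ^ 2 / ((p.1.1 : ℂ) * τ + p.1.2)))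

/-- `φ_{12, A₁} = (e₄² e_{4,1} - e₆ e_{6,1}) / 144`. -/
def phi12A1 (τ : ℍ) (z : ℂ) : ℂ :=
  1 / 144 * (ModularForm.E₄ τ ^ 2 * jacobiEisenstein 4 τ z
    - ModularForm.E₆ τ * jacobiEisenstein 6 τ z)

/-- `φ_{0,1} = φ_{12, A₁} / η ^ 24`. -/
def phi01 (τ : ℍ) (z : ℂ) : ℂ :=
  phi12A1 τ z / ModularForm.eta τ ^ 24

/-- `ϑ_{N A₁}(τ, z) = ∏ ϑ(τ, z_j)`. -/
def thetaNA1 (N : ℕ) (τ : ℍ) (z : Fin N → ℂ) : ℂ :=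
  ∏ j, theta τ (z j)

/-- `ϱ_{6 - N, N A₁} = η ^ (12 - 3 N) ϑ_{N A₁}`. -/
def rho (N : ℕ) (τ : ℍ) (z : Fin N → ℂ) : ℂ :=
  ModularForm.eta τ ^ (12 - 3 * (N : ℤ)) * thetaNA1 N τ z

/-- `ψ_{12 - 2 N, N A₁} = ϱ_{6 - N, N A₁} ^ 2`. -/
def psi (N : ℕ) (τ : ℍ) (z : Fin N → ℂ) : ℂ :=
  rho N τ z ^ 2

/-! ### The operations and the tower -/

/-- `(φ ⊗ φ_{0,1})(τ, (z_1, …, z_{N+1})) = φ(τ, (z_1, …, z_N)) φ_{0,1}(τ, z_{N+1})`. -/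
def tensorPhi01 {N : ℕ} (φ : ℍ → (Fin N → ℂ) → ℂ) (τ : ℍ) (z : Fin (N + 1) → ℂ) : ℂ :=
  φ τ (fun i => z i.castSucc) * phi01 τ (z (Fin.last N))

/-- The point `(z_1, …, z_N, w)`. -/
def appendCoord {N : ℕ} (z : Fin N → ℂ) (w : ℂ) : Fin (N + 1) → ℂ :=
  Fin.snoc (α := fun _ => ℂ) z w

/-- `φ → ψ`: the function `ψ` for `N A₁` is a nonzero multiple of the pullback of `φ`, i.e. of
the restriction of `φ` to `z_{N+1} = 0`. -/
def IsPullback {N : ℕ} (φ : ℍ → (Fin (N + 1) → ℂ) → ℂ) (ψ : ℍ → (Fin N → ℂ) → ℂ) : Prop :=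
  ∃ α : ℂ, α ≠ 0 ∧ ∀ τ z, ψ τ z = α * φ τ (appendCoord z 0)

/-- `ψ` is a nonzero multiple of the second derivative of `φ` in `z_{N+1}` at `z_{N+1} = 0`. -/
def IsQuasiPullback {N : ℕ} (φ : ℍ → (Fin (N + 1) → ℂ) → ℂ) (ψ : ℍ → (Fin N → ℂ) → ℂ) : Prop :=
  ∃ α : ℂ, α ≠ 0 ∧ ∀ τ z, ψ τ z = α * iteratedDeriv 2 (fun w => φ τ (appendCoord z w)) 0

/-- The top entry of the column of weight `12 - 2 m`: `Δ₁₂ = η ^ 24` for `m = 0` (for the lattice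
of rank `0`), and `ψ_{12 - 2 m, m A₁}` for `m ≥ 1`. -/
def columnTop : (m : ℕ) → ℍ → (Fin m → ℂ) → ℂ
  | 0 => fun τ _ => ModularForm.eta τ ^ 24
  | m + 1 => psi (m + 1)

/-- The entry of weight `12 - 2 m` for the lattice `(m + d) A₁`, obtained from the top of its
column by applying `⊗ φ_{0,1}` exactly `d` times. -/
def towerForm (m : ℕ) : (d : ℕ) → ℍ → (Fin (m + d) → ℂ) → ℂ
  | 0 => columnTop m
  | d + 1 => tensorPhi01 (towerForm m d)

end JacobiTower

end

noncomputable section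

namespace JacobiTower

open scoped ModularForm Manifold
open Complex Filter Topology Real UpperHalfPlane
open ModularGroup (S T)

/-! ### The exponential `e(x) = exp(2 π i x)` -/

/-! Every entry of the tower is a product Δ(τ) · ∏ p_j(τ, z_j) in which each p_j is one of two weak
Jacobi forms of index 1: φ_{-2,1} = ϑ²/η⁶ (`phiNegTwo`) and φ_{0,1} (`phi01`). Indeed (η^(12-3N) ∏
ϑ)² is Δ times N copies of ϑ²/η⁶. The Jacobi transformation laws multiply, so the content lies in
the Fourier support.

For a weak form of index 1, q^n ζ^r occurs only with n ≥ 0 and 4n - r² ≥ -1, while Δ has only terms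
with n ≥ 1. A product with N factors therefore has 4n - ∑ r_j² ≥ 4 - N, which is twice the
hyperbolic norm of the statement: positive for N ≤ 3, nonnegative for N = 4. The bound is sharp
because both weak forms have coefficient 1 at q⁰ζ^{±1}. Restricting to z_j = -τ/2 and rescaling by a
power of q isolates the extremal term and gives a nonzero limit at i∞ (`IsTowerEntry`,
`IsTowerEntry.mul`). For N = 4 a cusp form would have limit 0.

The properties of the two weak forms come from theta decompositions g₀ϑ₀ + g₁ϑ₁, with ϑ₀, ϑ₁ the
theta functions of index 1. For ϑ² this is a parity rearrangement of a double series (`theta_sq`).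
For the Jacobi-Eisenstein series, ϑ₀|γ = Aϑ₀ + Bϑ₁ with |A|² + |B|² = |cτ + d| (`IsThetaRow`), so
the series for g₀, g₁ converge locally uniformly and their limits at the cusp are 1 and 0
(`IsRowFamily.tendsto`). Hence the coefficients of φ_{12,A₁} vanish at i∞ and dividing by Δ leaves a
weak Jacobi form.

The constants come from Taylor expansion at z = 0. One has φ_{-2,1}(τ,0) = 0, and φ_{0,1}(τ,0) =
(E₄³ - E₆²)/(144Δ) = 12, which gives the pullbacks. The second derivative of φ_{-2,1} at 0 is a
modular form of weight 0, hence a nonzero constant, which gives the quasi-pullbacks. For φ_{0,1} the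
second derivative corrected by E₂ lies in M₂ = 0, and this fixes the coefficient at ζ^{±1}. -/

/-- `ex x = exp (2 π i x)`. -/
def ex (x : ℂ) : ℂ := Complex.exp (2 * π * Complex.I * x)

lemma ex_add (x y : ℂ) : ex (x + y) = ex x * ex y := by
  simp only [ex, mul_add, Complex.exp_add]

lemma ex_zero : ex 0 = 1 := by simp [ex]

lemma ex_ne_zero (x : ℂ) : ex x ≠ 0 := Complex.exp_ne_zero _

lemma ex_neg (x : ℂ) : ex (-x) = (ex x)⁻¹ := by
  simp only [ex, mul_neg, Complex.exp_neg]

lemma ex_sub (x y : ℂ) : ex (x - y) = ex x * (ex y)⁻¹ := by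
  rw [sub_eq_add_neg, ex_add, ex_neg]

lemma ex_intCast (n : ℤ) : ex n = 1 := by
  rw [ex, mul_comm, Complex.exp_int_mul_two_pi_mul_I]

lemma ex_add_intCast (x : ℂ) (n : ℤ) : ex (x + n) = ex x := by
  rw [ex_add, ex_intCast, mul_one]

lemma ex_quarter : ex (1 / 4) = Complex.I := by
  rw [ex, show 2 * (π : ℂ) * Complex.I * (1 / 4) = π / 2 * Complex.I by ring,
    Complex.exp_pi_div_two_mul_I]

lemma ex_half : ex (1 / 2) = -1 := by
  rw [ex, show 2 * (π : ℂ) * Complex.I * (1 / 2) = π * Complex.I by ring, Complex.exp_pi_mul_I]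

lemma ex_half_mul_intCast (n : ℤ) : ex (n / 2) = (-1) ^ n := by
  rw [ex, show 2 * (π : ℂ) * Complex.I * (n / 2) = n * (π * Complex.I) by ring,
    Complex.exp_int_mul, Complex.exp_pi_mul_I]

lemma ex_nsmul (n : ℕ) (x : ℂ) : ex (n * x) = ex x ^ n := by
  rw [ex, ex, ← Complex.exp_nat_mul]
  congr 1
  ring

lemma norm_ex (x : ℂ) : ‖ex x‖ = Real.exp (-(2 * π * x.im)) := by
  rw [ex, Complex.norm_exp]
  congr 1
  simp [mul_assoc, mul_re, mul_im]

lemma differentiable_ex : Differentiable ℂ ex := by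
  unfold ex
  fun_prop

lemma hasDerivAt_ex_mul (r z : ℂ) :
    HasDerivAt (fun w => ex (r * w)) (2 * π * Complex.I * r * ex (r * z)) z := by
  have h := ((hasDerivAt_id z).const_mul (2 * π * Complex.I * r)).cexp
  simp only [id, mul_one] at h
  simp only [ex, ← mul_assoc]
  rwa [mul_comm (2 * π * Complex.I * r)]

/-! ### Sums over the integers split by parity -/

lemma hasSum_int_even_add_odd {f : ℤ → ℂ} {a b : ℂ} (ha : HasSum (fun n : ℤ => f (2 * n)) a)
    (hb : HasSum (fun n : ℤ => f (2 * n + 1)) b) : HasSum f (a + b) := by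
  have h0 : Function.Injective (fun n : ℤ => 2 * n) := fun m n h => by
    simp only at h
    omega
  have h1 : Function.Injective (fun n : ℤ => 2 * n + 1) := fun m n h => by
    simp only at h
    omega
  refine HasSum.add_isCompl (s := Set.range fun n : ℤ => 2 * n)
    (t := Set.range fun n : ℤ => 2 * n + 1) ?_ (h0.hasSum_range_iff.mpr ha)
    (h1.hasSum_range_iff.mpr hb)
  constructor
  · rw [Set.disjoint_left]
    rintro _ ⟨m, rfl⟩ ⟨n, h⟩
    simp only at h
    omega
  · rw [codisjoint_iff, Set.top_eq_univ, Set.eq_univ_iff_forall]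
    intro n
    rcases Int.even_or_odd' n with ⟨k, rfl | rfl⟩
    · exact Or.inl ⟨k, rfl⟩
    · exact Or.inr ⟨k, rfl⟩

/-! ### The theta functions of index one -/

/-- `∑ e(n² τ + 2 n z)`. -/
def th0 (τ z : ℂ) : ℂ := jacobiTheta₂ (2 * z) (2 * τ)

/-- `∑ e((n + 1/2)² τ + (2 n + 1) z)`. -/
def th1 (τ z : ℂ) : ℂ := ex (τ / 4 + z) * jacobiTheta₂ (2 * z + τ) (2 * τ)

lemma two_mul_im_pos {τ : ℂ} (hτ : 0 < τ.im) : 0 < (2 * τ).im := by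
  simpa using hτ

lemma hasSum_th0 {τ : ℂ} (hτ : 0 < τ.im) (z : ℂ) :
    HasSum (fun n : ℤ => ex ((n : ℂ) ^ 2 * τ + 2 * n * z)) (th0 τ z) := by
  refine (hasSum_jacobiTheta₂_term (2 * z) (two_mul_im_pos hτ)).congr_fun fun n => ?_
  rw [jacobiTheta₂_term, ex]
  congr 1
  ring

lemma hasSum_th1 {τ : ℂ} (hτ : 0 < τ.im) (z : ℂ) :
    HasSum (fun n : ℤ => ex (((n : ℂ) ^ 2 + n + 1 / 4) * τ + (2 * n + 1) * z)) (th1 τ z) := by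
  refine ((hasSum_jacobiTheta₂_term (2 * z + τ) (two_mul_im_pos hτ)).mul_left _).congr_fun
    fun n => ?_
  rw [jacobiTheta₂_term, ex, ex, ← Complex.exp_add]
  congr 1
  ring

lemma th0_add_one (τ z : ℂ) : th0 (τ + 1) z = th0 τ z := by
  rw [th0, mul_add, mul_one, jacobiTheta₂_add_right, th0]

lemma th0_add_int (τ z : ℂ) (n : ℤ) : th0 (τ + n) z = th0 τ z := by
  have h : Function.Periodic (fun w => th0 w z) 1 := fun w => th0_add_one w z
  simpa using h.int_mul n τ

/-- All exponents (n + 1/2)² of q are congruent to 1/4 modulo 1. -/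
lemma th1_add_one {τ : ℂ} (hτ : 0 < τ.im) (z : ℂ) : th1 (τ + 1) z = Complex.I * th1 τ z := by
  have hτ' : 0 < (τ + 1).im := by simpa using hτ
  refine (hasSum_th1 hτ' z).unique (((hasSum_th1 hτ z).mul_left _).congr_fun fun n => ?_)
  rw [← ex_quarter, ← ex_add]
  obtain h := ex_add_intCast (1 / 4 + (((n : ℂ) ^ 2 + n + 1 / 4) * τ + (2 * n + 1) * z)) (n ^ 2 + n)
  rw [← h]
  congr 1
  push_cast
  ring

lemma th0_neg (τ z : ℂ) : th0 τ (-z) = th0 τ z := by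
  rw [th0, mul_neg, jacobiTheta₂_neg_left, th0]

lemma th0_add_half (τ z : ℂ) : th0 τ (z + 1 / 2) = th0 τ z := by
  rw [th0, mul_add, mul_one_div_cancel two_ne_zero, jacobiTheta₂_add_left, th0]

lemma th1_add_half (τ z : ℂ) : th1 τ (z + 1 / 2) = -th1 τ z := by
  rw [th1, show 2 * (z + 1 / 2) + τ = 2 * z + τ + 1 by ring, jacobiTheta₂_add_left, ← add_assoc,
    ex_add, ex_half, th1]
  ring

lemma th0_add_int_right (τ z : ℂ) (n : ℤ) : th0 τ (z + n) = th0 τ z := by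
  have h : Function.Periodic (fun w => th0 τ w) 1 := fun w => by
    have h2 := th0_add_half τ (w + 1 / 2)
    rw [add_assoc, add_halves] at h2
    exact h2.trans (th0_add_half τ w)
  simpa using h.int_mul n z

lemma th1_add_int_right (τ z : ℂ) (n : ℤ) : th1 τ (z + n) = th1 τ z := by
  have h : Function.Periodic (fun w => th1 τ w) 1 := fun w => by
    have h2 := th1_add_half τ (w + 1 / 2)
    rw [add_assoc, add_halves] at h2
    exact h2.trans (by rw [th1_add_half, neg_neg])
  simpa using h.int_mul n z

lemma th0_add_mul {τ : ℂ} (hτ : 0 < τ.im) (z : ℂ) (x : ℤ) :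
    th0 τ (z + x * τ) = ex (-((x : ℂ) ^ 2 * τ + 2 * x * z)) * th0 τ z := by
  refine (hasSum_th0 hτ _).unique ?_
  rw [← (Equiv.subRight x).hasSum_iff]
  refine ((hasSum_th0 hτ z).mul_left _).congr_fun fun n => ?_
  rw [Function.comp_apply, ← ex_add, Equiv.subRight_apply]
  congr 1
  push_cast
  ring

lemma th1_add_mul {τ : ℂ} (hτ : 0 < τ.im) (z : ℂ) (x : ℤ) :
    th1 τ (z + x * τ) = ex (-((x : ℂ) ^ 2 * τ + 2 * x * z)) * th1 τ z := by
  refine (hasSum_th1 hτ _).unique ?_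
  rw [← (Equiv.subRight x).hasSum_iff]
  refine ((hasSum_th1 hτ z).mul_left _).congr_fun fun n => ?_
  rw [Function.comp_apply, ← ex_add, Equiv.subRight_apply]
  congr 1
  push_cast
  ring

/-- Even and odd m in ∑ e(m²τ/4 + mz) give ϑ₀ and ϑ₁ respectively. -/
lemma th0_add_th1 {τ : ℂ} (hτ : 0 < τ.im) (z : ℂ) :
    th0 τ z + th1 τ z = jacobiTheta₂ z (τ / 2) := by
  have hτ' : 0 < (τ / 2).im := by
    rw [show τ / 2 = ((1 / 2 : ℝ) : ℂ) * τ by push_cast; ring, im_ofReal_mul]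
    positivity
  refine (hasSum_int_even_add_odd ((hasSum_th0 hτ z).congr_fun fun n => ?_)
    ((hasSum_th1 hτ z).congr_fun fun n => ?_)).unique (hasSum_jacobiTheta₂_term z hτ')
  all_goals
    rw [jacobiTheta₂_term, ex]
    congr 1
    push_cast
    ring

/-! ### Inversion formulas and linear independence of ϑ₀ and ϑ₁ -/

/-- The automorphy factor `(-i τ / 2)^(1/2)` of the theta functions. -/
def sq (τ : ℂ) : ℂ := (-Complex.I * (τ / 2)) ^ (1 / 2 : ℂ)

lemma sq_sq {τ : ℂ} : sq τ ^ 2 = -Complex.I * τ / 2 := by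
  rw [sq, ← Complex.cpow_nat_mul]
  norm_num
  ring

lemma sq_ne_zero {τ : ℂ} (hτ : 0 < τ.im) : sq τ ≠ 0 := by
  intro h
  have h2 := sq_sq (τ := τ)
  rw [h] at h2
  have : τ ≠ 0 := by
    rintro rfl
    simp at hτ
  have h3 : -Complex.I * τ / 2 ≠ 0 := by simp [this]
  exact h3 (by rw [← h2]; ring)

/-- The two bases differ by the positive factor 4, so no branch of the logarithm is crossed. -/
lemma cpow_two_mul_eq {τ : ℂ} (hτ : τ ≠ 0) : (-Complex.I * (2 * τ)) ^ (1 / 2 : ℂ) = 2 * sq τ := by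
  rw [sq, show -Complex.I * (2 * τ) = ((4 : ℝ) : ℂ) * (-Complex.I * (τ / 2)) by push_cast; ring]
  have h0 : -Complex.I * (τ / 2) ≠ 0 := by simp [hτ]
  rw [Complex.cpow_def_of_ne_zero (mul_ne_zero (by norm_num) h0), Complex.cpow_def_of_ne_zero h0,
    Complex.log_ofReal_mul (by norm_num) h0, add_mul, Complex.exp_add,
    show (4 : ℝ) = 2 ^ 2 by norm_num, Real.log_pow]
  congr 1
  rw [show ((((2 : ℕ) : ℝ) * Real.log 2 : ℝ) : ℂ) * (1 / 2) = (Real.log 2 : ℝ) by push_cast; ring,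
    ← Complex.ofReal_exp, Real.exp_log two_pos, ofReal_ofNat]

lemma neg_inv_im_pos {τ : ℂ} (hτ : 0 < τ.im) : 0 < (-1 / τ).im := by
  have := UpperHalfPlane.im_inv_neg_coe_pos ⟨τ, hτ⟩
  rwa [neg_div, one_div, neg_inv]

/-- The functional equation of the Jacobi theta function at τ/2, where it equals ϑ₀ + ϑ₁. The next
lemma uses the same equation at 2τ, and the difference of the two gives ϑ₁. -/
lemma th0_S {τ : ℂ} (hτ : 0 < τ.im) (z : ℂ) :
    th0 (-1 / τ) (z / τ) = sq τ * ex (z ^ 2 / τ) * (th0 τ z + th1 τ z) := by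
  have hτ0 : τ ≠ 0 := by rintro rfl; simp at hτ
  have h := jacobiTheta₂_functional_equation z (τ / 2)
  rw [th0_add_th1 hτ, h, th0, ← sq, show z / (τ / 2) = 2 * (z / τ) by field_simp,
    show -1 / (τ / 2) = 2 * (-1 / τ) by field_simp]
  have h2 : ex (z ^ 2 / τ) * cexp (-π * Complex.I * z ^ 2 / (τ / 2)) = 1 := by
    rw [ex, ← Complex.exp_add, ← Complex.exp_zero]
    congr 1
    field_simp
    ring
  have h3 := sq_ne_zero hτ
  rw [show ∀ a b c d : ℂ, a * b * (1 / a * c * d) = (a * (1 / a)) * (b * c) * d by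
    intros; ring, h2, mul_one_div_cancel h3]
  ring

lemma th0_add_th1_S {τ : ℂ} (hτ : 0 < τ.im) (z : ℂ) :
    th0 (-1 / τ) (z / τ) + th1 (-1 / τ) (z / τ) = 2 * sq τ * ex (z ^ 2 / τ) * th0 τ z := by
  have hτ0 : τ ≠ 0 := by rintro rfl; simp at hτ
  have h := jacobiTheta₂_functional_equation (2 * z) (2 * τ)
  rw [th0_add_th1 (neg_inv_im_pos hτ), th0, h, cpow_two_mul_eq hτ0,
    show 2 * z / (2 * τ) = z / τ by field_simp,
    show -1 / (2 * τ) = -1 / τ / 2 by field_simp]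
  have h2 : ex (z ^ 2 / τ) * cexp (-π * Complex.I * (2 * z) ^ 2 / (2 * τ)) = 1 := by
    rw [ex, ← Complex.exp_add, ← Complex.exp_zero]
    congr 1
    field_simp
    ring
  have h3 : 2 * sq τ ≠ 0 := mul_ne_zero two_ne_zero (sq_ne_zero hτ)
  rw [show ∀ a b c d : ℂ, a * b * (1 / a * c * d) = (a * (1 / a)) * (b * c) * d by
    intros; ring, h2, mul_one_div_cancel h3]
  ring

lemma th1_S {τ : ℂ} (hτ : 0 < τ.im) (z : ℂ) :
    th1 (-1 / τ) (z / τ) = sq τ * ex (z ^ 2 / τ) * (th0 τ z - th1 τ z) := by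
  linear_combination th0_add_th1_S hτ z - th0_S hτ z

/-- The integral over z in [0, 1] picks out the term n = 0, which is 1. -/
lemma exists_jacobiTheta₂_ne_zero {τ : ℂ} (hτ : 0 < τ.im) : ∃ z, jacobiTheta₂ z τ ≠ 0 := by
  by_contra! h
  have hs := hasSum_jacobiTheta₂_term 0 hτ
  have hn : ∀ (n : ℤ) (x : ℝ), ‖jacobiTheta₂_term n x τ‖ = ‖jacobiTheta₂_term n 0 τ‖ := by
    intro n x
    simp [norm_jacobiTheta₂_term]
  have hint := intervalIntegral.hasSum_integral_of_dominated_convergence (a := 0) (b := 1)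
    (μ := MeasureTheory.volume)
    (F := fun (n : ℤ) (x : ℝ) => jacobiTheta₂_term n x τ) (f := fun x : ℝ => jacobiTheta₂ x τ)
    (fun n _ => ‖jacobiTheta₂_term n 0 τ‖)
    (fun n => by
      refine Continuous.aestronglyMeasurable ?_
      unfold jacobiTheta₂_term
      fun_prop)
    (fun n => Eventually.of_forall fun x _ => (hn n x).le)
    (Eventually.of_forall fun x _ => hs.summable.norm)
    (by simp)
    (Eventually.of_forall fun x _ => hasSum_jacobiTheta₂_term x hτ)
  simp only [h, intervalIntegral.integral_zero] at hint
  have hval : ∀ n : ℤ, n ≠ 0 → ∫ x in (0:ℝ)..1, jacobiTheta₂_term n x τ = 0 := by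
    intro n hn0
    have hc : 2 * (π : ℂ) * Complex.I * n ≠ 0 := by simp [hn0, pi_ne_zero]
    have : ∀ x : ℝ, jacobiTheta₂_term n x τ =
        cexp (π * Complex.I * n ^ 2 * τ) * cexp (2 * π * Complex.I * n * x) := fun x => by
      rw [jacobiTheta₂_term, add_comm, Complex.exp_add]
    simp only [this]
    rw [intervalIntegral.integral_const_mul, integral_exp_mul_complex hc]
    have := ex_intCast n
    rw [ex] at this
    simp [this]
  have h1 := hasSum_ite_eq (0 : ℤ) (1 : ℂ)
  have h2 := hint.unique (h1.congr_fun fun n => ?_)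
  · exact zero_ne_one h2
  · split_ifs with hn0
    · subst hn0
      simp [jacobiTheta₂_term]
    · exact hval n hn0

/-- The shift z ↦ z + 1/2 fixes ϑ₀ and negates ϑ₁, so the relation splits into one for each; neither
function vanishes identically in z. -/
lemma th_linearIndependent {τ : ℂ} (hτ : 0 < τ.im) {u v u' v' : ℂ}
    (h : ∀ z, u * th0 τ z + v * th1 τ z = u' * th0 τ z + v' * th1 τ z) : u = u' ∧ v = v' := by
  obtain ⟨w, hw⟩ := exists_jacobiTheta₂_ne_zero (two_mul_im_pos hτ)
  have h0 : th0 τ (w / 2) ≠ 0 := by rwa [th0, mul_div_cancel₀ w two_ne_zero]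
  have h1 : th1 τ ((w - τ) / 2) ≠ 0 := by
    rw [th1, mul_div_cancel₀ _ two_ne_zero, sub_add_cancel]
    exact mul_ne_zero (ex_ne_zero _) hw
  have key : ∀ z, (u - u') * th0 τ z = 0 ∧ (v - v') * th1 τ z = 0 := by
    intro z
    have e1 := h z
    have e2 := h (z + 1 / 2)
    rw [th0_add_half, th1_add_half] at e2
    constructor
    · linear_combination (e1 + e2) / 2
    · linear_combination (e1 - e2) / 2
  constructor
  · exact sub_eq_zero.mp ((mul_eq_zero.mp (key _).1).resolve_right h0)
  · exact sub_eq_zero.mp ((mul_eq_zero.mp (key _).2).resolve_right h1)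

lemma differentiableAt_th0 {p : ℂ × ℂ} (hτ : 0 < p.1.im) :
    DifferentiableAt ℂ (fun p : ℂ × ℂ => th0 p.1 p.2) p := by
  have h := (hasFDerivAt_jacobiTheta₂ (2 * p.2) (two_mul_im_pos hτ)).differentiableAt
  exact h.comp (f := fun p : ℂ × ℂ => (2 * p.2, 2 * p.1)) p (by fun_prop)

lemma differentiableAt_th1 {p : ℂ × ℂ} (hτ : 0 < p.1.im) :
    DifferentiableAt ℂ (fun p : ℂ × ℂ => th1 p.1 p.2) p := by
  have h := (hasFDerivAt_jacobiTheta₂ (2 * p.2 + p.1) (two_mul_im_pos hτ)).differentiableAt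
  have h1 : DifferentiableAt ℂ (fun p : ℂ × ℂ => jacobiTheta₂ (2 * p.2 + p.1) (2 * p.1)) p :=
    h.comp (f := fun p : ℂ × ℂ => (2 * p.2 + p.1, 2 * p.1)) p (by fun_prop)
  exact (differentiable_ex.comp (by fun_prop :
    Differentiable ℂ fun p : ℂ × ℂ => p.1 / 4 + p.2)).differentiableAt.mul h1

/-! ### Functions on the upper half plane -/

lemma coe_S_smul (τ : ℍ) : ((S • τ : ℍ) : ℂ) = -1 / τ := by
  rw [UpperHalfPlane.modular_S_smul, UpperHalfPlane.coe_mk, inv_neg, neg_div, one_div]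

lemma coe_T_smul (τ : ℍ) : ((T • τ : ℍ) : ℂ) = τ + 1 := by
  rw [UpperHalfPlane.modular_T_smul, UpperHalfPlane.coe_vadd, add_comm, ofReal_one]

lemma denom_T (τ : ℍ) : UpperHalfPlane.denom T τ = 1 := by
  rw [ModularGroup.denom_apply, show T 1 0 = 0 from rfl, show T 1 1 = 1 from rfl]
  simp

/-- Holomorphic functions on the upper half plane. -/
def Hol (f : ℍ → ℂ) : Prop :=
  DifferentiableOn ℂ (fun w => f (ofComplex w)) {w | 0 < w.im}

lemma hol_iff {f : ℍ → ℂ} : Hol f ↔ MDiff f :=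
  UpperHalfPlane.mdifferentiable_iff.symm

lemma hol_of_differentiableOn {f : ℂ → ℂ} (hf : DifferentiableOn ℂ f {w | 0 < w.im}) :
    Hol (fun τ => f τ) := by
  refine hf.congr fun w hw => ?_
  simp only
  rw [ofComplex_apply_of_im_pos hw, UpperHalfPlane.coe_mk]

lemma Hol.add {f g : ℍ → ℂ} (hf : Hol f) (hg : Hol g) : Hol (fun τ => f τ + g τ) :=
  DifferentiableOn.fun_add hf hg

lemma Hol.sub {f g : ℍ → ℂ} (hf : Hol f) (hg : Hol g) : Hol (fun τ => f τ - g τ) :=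
  DifferentiableOn.fun_sub hf hg

lemma Hol.mul {f g : ℍ → ℂ} (hf : Hol f) (hg : Hol g) : Hol (fun τ => f τ * g τ) :=
  DifferentiableOn.fun_mul hf hg

lemma Hol.pow {f : ℍ → ℂ} (hf : Hol f) (n : ℕ) : Hol (fun τ => f τ ^ n) :=
  DifferentiableOn.fun_pow hf n

lemma Hol.neg {f : ℍ → ℂ} (hf : Hol f) : Hol (fun τ => -f τ) :=
  DifferentiableOn.fun_neg hf

lemma Hol.const_mul {f : ℍ → ℂ} (hf : Hol f) (c : ℂ) : Hol (fun τ => c * f τ) :=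
  DifferentiableOn.const_mul hf c

lemma Hol.div {f g : ℍ → ℂ} (hf : Hol f) (hg : Hol g) (h : ∀ τ, g τ ≠ 0) :
    Hol (fun τ => f τ / g τ) :=
  DifferentiableOn.fun_div hf hg fun _ _ => h _

lemma Hol.smul_comp {f : ℍ → ℂ} (hf : Hol f) (γ : SL(2, ℤ)) : Hol (fun τ => f (γ • τ)) := by
  rw [hol_iff] at hf ⊢
  exact hf.comp (UpperHalfPlane.mdifferentiable_smul (g := (γ : GL (Fin 2) ℝ)) (by simp))

lemma hol_ex_mul (c : ℂ) : Hol (fun τ => ex (c * τ)) :=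
  hol_of_differentiableOn (f := fun w => ex (c * w))
    (differentiable_ex.comp (by fun_prop : Differentiable ℂ fun w : ℂ => c * w)).differentiableOn

lemma hol_th0_zero : Hol (fun τ => th0 τ 0) :=
  hol_of_differentiableOn fun w hw => ((differentiableAt_th0 (p := (w, 0)) hw).comp w
    (f := fun w : ℂ => (w, (0 : ℂ))) (by fun_prop)).differentiableWithinAt

lemma hol_th1_zero : Hol (fun τ => th1 τ 0) :=
  hol_of_differentiableOn fun w hw => ((differentiableAt_th1 (p := (w, 0)) hw).comp w
    (f := fun w : ℂ => (w, (0 : ℂ))) (by fun_prop)).differentiableWithinAt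

lemma periodic_of_T_smul {f : ℍ → ℂ} (hf : ∀ τ, f (T • τ) = f τ) :
    Function.Periodic (f ∘ ofComplex) (1 : ℝ) := by
  intro w
  by_cases hw : 0 < w.im
  · have hw' : 0 < (w + (1 : ℝ)).im := by simpa using hw
    rw [Function.comp_apply, Function.comp_apply, ofComplex_apply_of_im_pos hw,
      ofComplex_apply_of_im_pos hw', ← hf ⟨w, hw⟩]
    congr 1
    ext1
    rw [coe_T_smul]
    simp
  -- Off the upper half plane `ofComplex` takes one constant junk value, so periodicity is trivial
  -- there.
  · have hw' : (w + (1 : ℝ)).im ≤ 0 := by simpa using hw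
    rw [Function.comp_apply, Function.comp_apply, ofComplex_apply_of_im_nonpos (not_lt.mp hw),
      ofComplex_apply_of_im_nonpos hw']

lemma exists_hasSum_of_bounded {f : ℍ → ℂ} (hf : Hol f) (hT : ∀ τ, f (T • τ) = f τ)
    (hb : IsBoundedAtImInfty f) :
    ∃ a : ℕ → ℂ, ∀ τ : ℍ, HasSum (fun m : ℕ => a m * ex (m * τ)) (f τ) := by
  refine ⟨fun m => (qExpansion 1 f).coeff m, fun τ => ?_⟩
  refine (hasSum_qExpansion one_pos (periodic_of_T_smul hT) (hol_iff.mp hf) hb τ).congr_fun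
    fun m => ?_
  rw [ex_nsmul, smul_eq_mul, Function.Periodic.qParam, ex, ofReal_one, div_one]

lemma isBigO_exp_of_tendsto_zero {f : ℍ → ℂ} (hf : Hol f) (hT : ∀ τ, f (T • τ) = f τ)
    (hz : Tendsto f atImInfty (𝓝 0)) :
    f =O[atImInfty] fun τ => Real.exp (-2 * π * τ.im) := by
  have h := IsZeroAtImInfty.exp_decay_atImInfty (f := f) hz one_pos (periodic_of_T_smul hT)
    (hol_iff.mp hf) (IsZeroAtImInfty.isBoundedAtImInfty hz)
  simpa using h

/-- S and T generate the group. Invariance then carries the bound at i∞ to every other cusp. -/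
lemma exists_modularForm {f : ℍ → ℂ} {k : ℤ} (hf : Hol f) (hS : ∀ τ : ℍ, f (S • τ) = τ ^ k * f τ)
    (hT : ∀ τ, f (T • τ) = f τ) (hb : IsBoundedAtImInfty f) :
    ∃ F : ModularForm 𝒮ℒ k, ∀ τ, F τ = f τ := by
  have hS' : f ∣[k] S = f := by
    ext τ
    rw [ModularForm.SL_slash_apply, ModularGroup.denom_S, hS, mul_comm, ← mul_assoc,
      ← zpow_add₀ τ.ne_zero, neg_add_cancel, zpow_zero, one_mul]
  have hT' : f ∣[k] T = f := by
    ext τ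
    rw [ModularForm.SL_slash_apply, hT, denom_T, one_zpow, mul_one]
  have h := SlashInvariantForm.slash_action_generators_SL2Z hS' hT'
  exact ⟨{
    toFun := f
    slash_action_eq' := fun A hA => by
      obtain ⟨A, rfl⟩ := hA
      exact h A
    holo' := hol_iff.mp hf
    bdd_at_cusps' := fun hc => by
      rw [Subgroup.IsArithmetic.isCusp_iff_isCusp_SL2Z] at hc
      rw [OnePoint.isBoundedAt_iff_forall_SL2Z hc]
      intro γ _
      rw [h]
      exact hb }, fun τ => rfl⟩

/-! ### Limits of exponential series at the cusp -/

lemma one_le_im_eventually : ∀ᶠ τ : ℍ in atImInfty, 1 ≤ τ.im :=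
  atImInfty_mem _ |>.mpr ⟨1, fun _ h => h⟩

lemma tendsto_ex_mul {r : ℝ} (hr : 0 < r) :
    Tendsto (fun τ : ℍ => ex (r * τ)) atImInfty (𝓝 0) := by
  rw [tendsto_zero_iff_norm_tendsto_zero]
  have h : ∀ τ : ℍ, ‖ex (r * τ)‖ = Real.exp (-((2 * π * r) * τ.im)) := fun τ => by
    rw [norm_ex, im_ofReal_mul, UpperHalfPlane.coe_im, mul_assoc (2 * π)]
  simp only [h]
  have h2 : Tendsto (fun τ : ℍ => (2 * π * r) * τ.im) atImInfty atTop :=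
    Tendsto.const_mul_atTop (by positivity) tendsto_comap
  exact Real.tendsto_exp_neg_atTop_nhds_zero.comp h2

/-- Dominated convergence: since the exponents are nonnegative, the terms at τ = i dominate those at
every τ with Im τ ≥ 1. Real exponents are allowed so that specializations such as z = -τ/2 are
covered. -/
lemma tendsto_atImInfty_of_hasSum {ι : Type*} {c : ι → ℂ} {r : ι → ℝ} {F : ℍ → ℂ}
    (hr : ∀ i, c i ≠ 0 → 0 ≤ r i) (hF : ∀ τ : ℍ, HasSum (fun i => c i * ex (r i * τ)) (F τ)) :
    Tendsto F atImInfty (𝓝 (∑' i, if r i = 0 then c i else 0)) := by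
  have hF' : F = fun τ : ℍ => ∑' i, c i * ex (r i * τ) := funext fun τ => (hF τ).tsum_eq.symm
  rw [hF']
  refine tendsto_tsum_of_dominated_convergence
    (bound := fun i => ‖c i * ex (r i * UpperHalfPlane.I)‖)
    (hF UpperHalfPlane.I).summable.norm ?_ ?_
  · intro i
    by_cases hc : c i = 0
    · simp [hc]
    split_ifs with h0
    · simp [h0, ex_zero]
    · simpa using (tendsto_ex_mul ((hr i hc).lt_of_ne' h0)).const_mul (c i)
  · filter_upwards [one_le_im_eventually] with τ hτ i
    by_cases hc : c i = 0
    · simp [hc]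
    rw [norm_mul, norm_mul, norm_ex, norm_ex]
    have := hr i hc
    simp only [im_ofReal_mul, UpperHalfPlane.coe_im, UpperHalfPlane.I_im, mul_one]
    gcongr
    exact le_mul_of_one_le_right this hτ

lemma hol_of_hasSum {ι : Type*} {c : ι → ℂ} {n : ι → ℤ} {F : ℍ → ℂ}
    (hn : ∀ i, c i ≠ 0 → 0 ≤ n i) (hF : ∀ τ : ℍ, HasSum (fun i => c i * ex (n i * τ)) (F τ)) :
    Hol F := by
  intro w hw
  have hw : 0 < w.im := hw
  -- The terms at height Im w / 2 dominate the series uniformly on the half plane above that height,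
  -- which contains w.
  let w' : ℍ := ⟨((w.im / 2 : ℝ) : ℂ) * Complex.I, by simpa using hw⟩
  have hw' : (w' : ℂ).im = w.im / 2 := by simp [w']
  have hU : IsOpen {u : ℂ | w.im / 2 < u.im} := isOpen_lt continuous_const continuous_im
  have h := differentiableOn_tsum_of_summable_norm (F := fun i u => c i * ex (n i * u))
    (U := {u : ℂ | w.im / 2 < u.im})
    (hF w').summable.norm (fun i => ((differentiable_ex.comp (by fun_prop :
      Differentiable ℂ fun u : ℂ => (n i : ℂ) * u)).const_mul _).differentiableOn) hU ?_
  · have hmem : w ∈ {u : ℂ | w.im / 2 < u.im} := by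
      simp only [Set.mem_ofPred_eq]
      linarith
    refine DifferentiableAt.differentiableWithinAt ?_
    refine (h.differentiableAt (hU.mem_nhds hmem)).congr_of_eventuallyEq ?_
    filter_upwards [hU.mem_nhds hmem] with u hu
    have hu0 : 0 < u.im := lt_trans (by linarith) hu
    rw [ofComplex_apply_of_im_pos hu0]
    exact (hF ⟨u, hu0⟩).tsum_eq.symm
  · intro i u hu
    by_cases hc : c i = 0
    · simp [hc]
    have h0 : (0 : ℝ) ≤ n i := by exact_mod_cast hn i hc
    rw [norm_mul, norm_mul, norm_ex, norm_ex]
    have e : ∀ v : ℂ, ((n i : ℂ) * v).im = n i * v.im := fun v => by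
      rw [← ofReal_intCast, im_ofReal_mul]
    rw [e, e, hw']
    gcongr
    exact le_of_lt hu

lemma T_smul_of_hasSum {ι : Type*} {c : ι → ℂ} {n : ι → ℤ} {F : ℍ → ℂ}
    (hF : ∀ τ : ℍ, HasSum (fun i => c i * ex (n i * τ)) (F τ)) (τ : ℍ) : F (T • τ) = F τ := by
  refine (hF _).unique ((hF τ).congr_fun fun i => ?_)
  rw [coe_T_smul, mul_add, mul_one, ex_add_intCast]

/-! ### Standard modular forms -/

lemma tendsto_E2 : Tendsto EisensteinSeries.E2 atImInfty (𝓝 1) := by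
  have h := tendsto_atImInfty_of_hasSum (r := fun m : ℕ => (m : ℝ))
    (c := fun m : ℕ => (if m = 0 then 1 else -24 * ArithmeticFunction.sigma 1 m : ℂ))
    (F := EisensteinSeries.E2) (fun m _ => m.cast_nonneg)
    fun τ => (EisensteinSeries.hasSum_qExpansion_E2 (z := τ)).congr_fun fun m => by
      rw [smul_eq_mul, ofReal_natCast, ex_nsmul, ex]
  convert! h
  rw [tsum_eq_single 0 fun m hm => by simp [hm]]
  simp

lemma tendsto_E {k : ℕ} (hk : 3 ≤ k) (hk2 : Even k) :
    Tendsto (ModularForm.E hk) atImInfty (𝓝 1) := by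
  have h := tendsto_atImInfty_of_hasSum (r := fun m : ℕ => (m : ℝ))
    (c := fun m : ℕ => (qExpansion 1 (ModularForm.E hk)).coeff m)
    (F := ModularForm.E hk) (fun m _ => m.cast_nonneg)
    fun τ => (ModularForm.hasSum_qExpansion (f := ModularForm.E hk) one_pos
      one_mem_strictPeriods_SL τ).congr_fun fun m => by
      rw [ofReal_natCast, ex_nsmul, ex, Function.Periodic.qParam, ofReal_one, div_one]
  convert! h
  rw [tsum_eq_single 0 fun m hm => by simp [hm]]
  simp [EisensteinSeries.E_qExpansion_coeff_zero hk hk2]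

lemma E2_S_smul (τ : ℍ) : EisensteinSeries.E2 (S • τ) =
    τ ^ 2 * EisensteinSeries.E2 τ - 6 * Complex.I * τ / π := by
  have h := congrFun (EisensteinSeries.E2_slash_action S) τ
  rw [ModularForm.SL_slash_apply, ModularGroup.denom_S] at h
  simp only [Pi.sub_apply, Pi.smul_apply, EisensteinSeries.D2_S, riemannZeta_two] at h
  have h0 := τ.ne_zero
  have hpi : (π : ℂ) ≠ 0 := ofReal_ne_zero.mpr pi_ne_zero
  rw [zpow_neg, zpow_ofNat, ← div_eq_mul_inv, div_eq_iff (pow_ne_zero 2 h0)] at h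
  rw [h, smul_eq_mul]
  field_simp

lemma E2_T_smul (τ : ℍ) : EisensteinSeries.E2 (T • τ) = EisensteinSeries.E2 τ := by
  have h := congrFun (EisensteinSeries.E2_slash_action T) τ
  rw [ModularForm.SL_slash_apply, denom_T] at h
  simpa [EisensteinSeries.D2_T] using h

lemma modularForm_S_smul {k : ℤ} (f : ModularForm 𝒮ℒ k) (τ : ℍ) :
    f (S • τ) = τ ^ k * f τ := by
  have h : (f : ℍ → ℂ) ∣[k] S = f := f.slash_action_eq' _ ⟨S, rfl⟩
  have h2 := congrFun h τ
  rw [ModularForm.SL_slash_apply, ModularGroup.denom_S, zpow_neg, ← div_eq_mul_inv,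
    div_eq_iff (zpow_ne_zero _ τ.ne_zero)] at h2
  rw [h2, mul_comm]

lemma modularForm_T_smul {k : ℤ} (f : ModularForm 𝒮ℒ k) (τ : ℍ) : f (T • τ) = f τ := by
  have h : (f : ℍ → ℂ) ∣[k] T = f := f.slash_action_eq' _ ⟨T, rfl⟩
  have h2 := congrFun h τ
  rwa [ModularForm.SL_slash_apply, denom_T, one_zpow, mul_one] at h2

/-! ### The eta function -/

lemma eta_ne_zero (τ : ℍ) : ModularForm.eta τ ≠ 0 := ModularForm.eta_ne_zero τ.2

lemma hol_eta : Hol (fun τ => ModularForm.eta τ) :=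
  hol_of_differentiableOn fun _ hw =>
    (ModularForm.differentiableAt_eta_of_mem_upperHalfPlaneSet hw).differentiableWithinAt

/-- The quotient is ∏ (1 - q^n), which tends to 1 as q → 0 by comparison with a geometric series. -/
lemma tendsto_eta_div : Tendsto (fun τ : ℍ => ModularForm.eta τ / ex (τ / 24)) atImInfty (𝓝 1) := by
  have htprod : Tendsto (fun q : ℂ ↦ ∏' (n : ℕ), (1 - q ^ (n + 1))) (𝓝 0) (𝓝 1) := by
    have := tendsto_tprod_one_add_of_dominated_convergence (𝓕 := 𝓝 0) (g := 0)
      (f := fun (q : ℂ) (n : ℕ) ↦ -q ^ (n + 1)) (bound := fun n ↦ (1 / 2 : ℝ) ^ (n + 1))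
    simp only [Pi.zero_apply, norm_neg, norm_pow, add_zero, tprod_one] at this
    simp_rw [sub_eq_add_neg]
    refine this
      (by simpa only [pow_succ'] using (summable_geometric_of_abs_lt_one (by norm_num)).mul_left _)
      (fun k ↦ by simpa using ((continuous_pow (M := ℂ) (k + 1)).tendsto 0).neg) ?_
    filter_upwards [Metric.ball_mem_nhds (0 : ℂ) (by norm_num : (0 : ℝ) < 1 / 2)] with q hq k
    exact pow_le_pow_left₀ (norm_nonneg _) (mem_ball_zero_iff.mp hq).le _
  refine (htprod.comp (UpperHalfPlane.qParam_tendsto_atImInfty zero_lt_one)).congr fun τ => ?_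
  rw [ModularForm.eta, Function.Periodic.qParam, ex, ofReal_ofNat, mul_div_assoc (2 * (π : ℂ) * _),
    mul_div_cancel_left₀ _ (Complex.exp_ne_zero _)]
  simp [ModularForm.eta_q, Function.Periodic.qParam]

lemma eta_pow_six_T_smul (τ : ℍ) :
    ModularForm.eta (T • τ : ℍ) ^ 6 = Complex.I * ModularForm.eta τ ^ 6 := by
  have h : ModularForm.eta (T • τ : ℍ) = ex (1 / 24) * ModularForm.eta τ := by
    rw [coe_T_smul, ModularForm.eta, ModularForm.eta, ← mul_assoc]
    congr 1
    · simp only [Function.Periodic.qParam, ex, ← Complex.exp_add]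
      congr 1
      push_cast
      ring
    · refine tprod_congr fun n => ?_
      rw [ModularForm.eta_q_eq_cexp, ModularForm.eta_q_eq_cexp]
      have := ex_add_intCast ((n + 1) * τ) (n + 1)
      rw [ex, ex] at this
      rw [show ∀ w : ℂ, 2 * (π : ℂ) * Complex.I * (n + 1) * w = 2 * π * Complex.I * ((n + 1) * w)
        from fun w => by ring, mul_assoc _ _ (τ : ℂ), ← this]
      congr 3
      push_cast
      ring
  rw [h, mul_pow, ← ex_nsmul, ← ex_quarter]
  norm_num

/-- The sixth power turns the square roots of the η-transformation into cubes, so no choice of root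
remains. -/
lemma eta_pow_six_S_smul (τ : ℍ) :
    ModularForm.eta (S • τ : ℍ) ^ 6 = Complex.I * τ ^ 3 * ModularForm.eta τ ^ 6 := by
  have h := ModularForm.eta_comp_eq_csqrt_I_inv τ.2
  simp only [Function.comp_apply, Pi.smul_apply, Pi.mul_apply, smul_eq_mul] at h
  have hs : ∀ z : ℂ, z ≠ 0 → Complex.sqrt z ^ 6 = z ^ 3 := fun z hz => by
    rw [_root_.sqrt_eq_exp hz, ← Complex.exp_nat_mul,
      show ((6 : ℕ) : ℂ) * (log z / 2) = (3 : ℕ) * log z by push_cast; ring, Complex.exp_nat_mul,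
      Complex.exp_log hz]
  rw [coe_S_smul, h, mul_pow, mul_pow, inv_pow, hs _ Complex.I_ne_zero, hs _ τ.ne_zero,
    Complex.I_pow_three, inv_neg, Complex.inv_I, neg_neg, mul_assoc]

lemma hol_discriminant : Hol ModularForm.discriminant :=
  hol_iff.mpr CuspForm.discriminant.holo'

lemma discriminant_S_smul (τ : ℍ) :
    ModularForm.discriminant (S • τ) = τ ^ 12 * ModularForm.discriminant τ := by
  simp only [ModularForm.discriminant]
  rw [show 24 = 6 * 4 by norm_num, pow_mul, eta_pow_six_S_smul, pow_mul, mul_pow, mul_pow,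
    Complex.I_pow_four, one_mul, ← pow_mul]

lemma discriminant_T_smul (τ : ℍ) :
    ModularForm.discriminant (T • τ) = ModularForm.discriminant τ := by
  simp only [ModularForm.discriminant]
  rw [show 24 = 6 * 4 by norm_num, pow_mul, eta_pow_six_T_smul, pow_mul, mul_pow,
    Complex.I_pow_four, one_mul]

lemma tendsto_discriminant_div :
    Tendsto (fun τ : ℍ => ModularForm.discriminant τ / ex τ) atImInfty (𝓝 1) := by
  have h := tendsto_eta_div.pow 24
  rw [one_pow] at h
  refine h.congr fun τ => ?_
  rw [div_pow, ← ex_nsmul, ModularForm.discriminant]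
  congr 2
  push_cast
  ring

/-! ### Theta decompositions -/

/-- `p = g₀ ϑ₀ + g₁ ϑ₁` with holomorphic `g₀`, `g₁` of the behaviour under `τ ↦ τ + 1` that makes
`p` invariant. -/
structure ThetaDecomp (p : ℍ → ℂ → ℂ) (g0 g1 : ℍ → ℂ) : Prop where
  eq : ∀ τ z, p τ z = g0 τ * th0 τ z + g1 τ * th1 τ z
  hol0 : Hol g0
  hol1 : Hol g1
  T0 : ∀ τ, g0 (T • τ) = g0 τ
  T1 : ∀ τ, g1 (T • τ) = -Complex.I * g1 τ

/-- Weak Jacobi forms of weight `k` and index one, given through their theta decomposition. -/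
structure WeakJacobi (k : ℤ) (p : ℍ → ℂ → ℂ) : Prop where
  S_smul : ∀ (τ : ℍ) (z : ℂ), p (S • τ) (z / τ) = (τ : ℂ) ^ k * ex (z ^ 2 / τ) * p τ z
  exists_decomp : ∃ g0 g1, ThetaDecomp p g0 g1 ∧ IsBoundedAtImInfty g0 ∧
    IsBoundedAtImInfty fun τ => ex (τ / 4) * g1 τ

/-- `f` is the family of Fourier coefficients of a weak Jacobi form of index one whose
coefficients at `ζ` and `ζ⁻¹` are equal to `b`. -/
structure WeakExpansion (p : ℍ → ℂ → ℂ) (b : ℂ) (f : ℤ × ℤ → ℂ) : Prop where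
  hasSum : ∀ (τ : ℍ) (z : ℂ), HasSum (fun i : ℤ × ℤ => f i * ex (i.1 * τ + i.2 * z)) (p τ z)
  support : ∀ i, f i ≠ 0 → 0 ≤ i.1 ∧ -1 ≤ 4 * i.1 - i.2 ^ 2
  coeff_one : f (0, 1) = b
  coeff_neg_one : f (0, -1) = b

namespace ThetaDecomp

variable {p : ℍ → ℂ → ℂ} {g0 g1 : ℍ → ℂ}

lemma T_smul (h : ThetaDecomp p g0 g1) (τ : ℍ) (z : ℂ) : p (T • τ) z = p τ z := by
  rw [h.eq, h.eq, h.T0, h.T1, coe_T_smul, th0_add_one, th1_add_one τ.2]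
  linear_combination (-(g1 τ) * th1 τ z) * Complex.I_mul_I

lemma heis (h : ThetaDecomp p g0 g1) (τ : ℍ) (z : ℂ) (x y : ℤ) :
    p τ (z + x * τ + y) = ex (-((x : ℂ) ^ 2 * τ + 2 * x * z)) * p τ z := by
  rw [h.eq, h.eq, th0_add_int_right, th1_add_int_right, th0_add_mul τ.2, th1_add_mul τ.2]
  ring

lemma differentiableOn (h : ThetaDecomp p g0 g1) :
    DifferentiableOn ℂ (fun q : ℂ × ℂ => p (ofComplex q.1) q.2) {q | 0 < q.1.im} := by
  have hg : ∀ {g : ℍ → ℂ}, Hol g →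
      DifferentiableOn ℂ (fun q : ℂ × ℂ => g (ofComplex q.1)) {q | 0 < q.1.im} := fun hg =>
    DifferentiableOn.comp (f := fun q : ℂ × ℂ => q.1) hg (by fun_prop) fun _ hq => hq
  have hth : DifferentiableOn ℂ (fun q : ℂ × ℂ => g0 (ofComplex q.1) * th0 q.1 q.2 +
      g1 (ofComplex q.1) * th1 q.1 q.2) {q | 0 < q.1.im} :=
    ((hg h.hol0).fun_mul fun q hq => (differentiableAt_th0 hq).differentiableWithinAt).fun_add
      ((hg h.hol1).fun_mul fun q hq => (differentiableAt_th1 hq).differentiableWithinAt)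
  refine hth.congr fun q hq => ?_
  rw [h.eq, ofComplex_apply_of_im_pos hq, UpperHalfPlane.coe_mk]

lemma tendsto_coeff_zero {a : ℕ → ℂ} {F : ℍ → ℂ}
    (h : ∀ τ : ℍ, HasSum (fun m : ℕ => a m * ex (m * τ)) (F τ)) :
    Tendsto F atImInfty (𝓝 (a 0)) := by
  have := tendsto_atImInfty_of_hasSum (r := fun m : ℕ => (m : ℝ)) (c := a) (F := F)
    (fun m _ => m.cast_nonneg) (by simpa using h)
  rwa [tsum_eq_single 0 fun m hm => by simp [hm], if_pos (by simp)] at this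

end ThetaDecomp

/-! ### Fourier coefficients from a theta decomposition -/

lemma hasSum_mul_complex {ι κ : Type*} {f : ι → ℂ} {g : κ → ℂ} {a b : ℂ} (hf : HasSum f a)
    (hg : HasSum g b) : HasSum (fun i : ι × κ => f i.1 * g i.2) (a * b) :=
  hf.mul hg (summable_mul_of_summable_norm hf.summable.norm hg.summable.norm)

lemma hasSum_extend_mul {ι κ : Type*} {i : ι → κ} (hi : Function.Injective i) {c : ι → ℂ}
    {E : κ → ℂ} {x : ℂ} (hs : HasSum (fun k => c k * E (i k)) x) :
    HasSum (fun j => Function.extend i c 0 j * E j) x := by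
  refine (hi.hasSum_iff fun j hj => ?_).mp (hs.congr_fun fun k => ?_)
  · rw [Function.extend_apply' _ _ _ fun ⟨k, hk⟩ => hj ⟨k, hk⟩, Pi.zero_apply, zero_mul]
  · rw [Function.comp_apply, hi.extend_apply]

lemma exists_of_extend_ne_zero {ι κ : Type*} {i : ι → κ} {c : ι → ℂ} {j : κ}
    (hj : Function.extend i c 0 j ≠ 0) : ∃ k, i k = j := by
  by_contra hk
  exact hj (Function.extend_apply' _ _ _ hk)

/-- The exponents `(n, r)` of the terms of `∑ a(m) q^m · ϑ₀`. -/
def expo0 (i : ℕ × ℤ) : ℤ × ℤ := (i.1 + i.2 ^ 2, 2 * i.2)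

/-- The exponents `(n, r)` of the terms of `q^(-1/4) ∑ b(m) q^m · ϑ₁`. -/
def expo1 (i : ℕ × ℤ) : ℤ × ℤ := (i.1 + i.2 ^ 2 + i.2, 2 * i.2 + 1)

lemma expo0_injective : Function.Injective expo0 := by
  rintro ⟨m, s⟩ ⟨m', s'⟩ hh
  simp only [expo0, Prod.mk.injEq] at hh
  obtain ⟨hh1, hh2⟩ := hh
  obtain rfl : s = s' := by omega
  simp at hh1
  simp [hh1]

lemma expo1_injective : Function.Injective expo1 := by
  rintro ⟨m, s⟩ ⟨m', s'⟩ hh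
  simp only [expo1, Prod.mk.injEq] at hh
  obtain ⟨hh1, hh2⟩ := hh
  obtain rfl : s = s' := by omega
  simp at hh1
  simp [hh1]

/-- Here 4n - r² = 4m. For `expo1` it is 4m - 1, the source of the bound -1. -/
lemma expo0_support (i : ℕ × ℤ) :
    0 ≤ (expo0 i).1 ∧ -1 ≤ 4 * (expo0 i).1 - (expo0 i).2 ^ 2 := by
  obtain ⟨m, s⟩ := i
  have hm : (0 : ℤ) ≤ m := Nat.cast_nonneg m
  simp only [expo0]
  constructor
  · positivity
  · nlinarith

lemma expo1_support (i : ℕ × ℤ) :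
    0 ≤ (expo1 i).1 ∧ -1 ≤ 4 * (expo1 i).1 - (expo1 i).2 ^ 2 := by
  obtain ⟨m, s⟩ := i
  have hm : (0 : ℤ) ≤ m := Nat.cast_nonneg m
  simp only [expo1]
  constructor
  · rcases le_or_gt 0 s with hs | hs
    · positivity
    · nlinarith
  · nlinarith

lemma expo0_ne (i : ℕ × ℤ) {n s : ℤ} : expo0 i ≠ (n, 2 * s + 1) := by
  simp only [expo0, ne_eq, Prod.mk.injEq, not_and]
  intro _
  omega

lemma hasSum_expo0 {a : ℕ → ℂ} {g : ℍ → ℂ}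
    (ha : ∀ τ : ℍ, HasSum (fun m : ℕ => a m * ex (m * τ)) (g τ)) (τ : ℍ) (z : ℂ) :
    HasSum (fun k : ℕ × ℤ => a k.1 * ex ((expo0 k).1 * τ + (expo0 k).2 * z))
      (g τ * th0 τ z) := by
  refine (hasSum_mul_complex (ha τ) (hasSum_th0 τ.2 z)).congr_fun fun k => ?_
  rw [mul_assoc, ← ex_add]
  congr 2
  simp only [expo0]
  push_cast
  ring

lemma hasSum_expo1 {b : ℕ → ℂ} {g : ℍ → ℂ}
    (hb : ∀ τ : ℍ, HasSum (fun m : ℕ => b m * ex (m * τ)) (ex (τ / 4) * g τ)) (τ : ℍ) (z : ℂ) :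
    HasSum (fun k : ℕ × ℤ => b k.1 * ex ((expo1 k).1 * τ + (expo1 k).2 * z))
      (g τ * th1 τ z) := by
  have hs := (hasSum_mul_complex (hb τ) (hasSum_th1 τ.2 z)).mul_left (ex (-(τ / 4)))
  rw [show ex (-(τ / 4)) * (ex (τ / 4) * g τ * th1 τ z) = g τ * th1 τ z by
    rw [mul_assoc, ← mul_assoc, ← ex_add, neg_add_cancel, ex_zero, one_mul]] at hs
  refine hs.congr_fun fun k => ?_
  rw [mul_assoc, mul_left_comm, ← ex_add, ← ex_add]
  congr 2
  simp only [expo1]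
  push_cast
  ring

/-- g₀ and q^(1/4) g₁ are bounded and invariant under T, hence power series in q. The ϑ₀ part has
only even r and the ϑ₁ part only odd r, so ζ and ζ⁻¹ at q⁰ both receive the constant term of q^(1/4)
g₁, that is, its limit at i∞. -/
lemma ThetaDecomp.exists_weakExpansion {p : ℍ → ℂ → ℂ} {g0 g1 : ℍ → ℂ}
    (h : ThetaDecomp p g0 g1) (h0 : IsBoundedAtImInfty g0)
    (h1 : IsBoundedAtImInfty fun τ => ex (τ / 4) * g1 τ) :
    ∃ b f, WeakExpansion p b f ∧ Tendsto (fun τ : ℍ => ex (τ / 4) * g1 τ) atImInfty (𝓝 b) := by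
  obtain ⟨a, ha⟩ := exists_hasSum_of_bounded h.hol0 h.T0 h0
  have hol : Hol fun τ : ℍ => ex (τ / 4) * g1 τ := by
    have := (hol_ex_mul (1 / 4)).mul h.hol1
    simpa only [one_div, ← div_eq_inv_mul] using this
  obtain ⟨b, hb⟩ := exists_hasSum_of_bounded hol
    (fun τ => by
      rw [coe_T_smul, h.T1, add_div, ex_add, ex_quarter]
      linear_combination (-(ex (τ / 4) * g1 τ)) * Complex.I_mul_I) h1
  refine ⟨b 0, fun j => Function.extend expo0 (fun k => a k.1) 0 j +
    Function.extend expo1 (fun k => b k.1) 0 j, ⟨?_, ?_, ?_, ?_⟩,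
    ThetaDecomp.tendsto_coeff_zero hb⟩
  · intro τ z
    rw [h.eq]
    refine ((hasSum_extend_mul expo0_injective (E := fun j => ex (j.1 * τ + j.2 * z))
      (hasSum_expo0 ha τ z)).add (hasSum_extend_mul expo1_injective
      (E := fun j => ex (j.1 * τ + j.2 * z)) (hasSum_expo1 hb τ z))).congr_fun fun j => ?_
    rw [add_mul]
  · intro j hj
    by_cases h2 : Function.extend expo0 (fun k => a k.1) 0 j = 0
    · simp only [h2, zero_add] at hj
      obtain ⟨k, rfl⟩ := exists_of_extend_ne_zero hj
      exact expo1_support k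
    · obtain ⟨k, rfl⟩ := exists_of_extend_ne_zero h2
      exact expo0_support k
  · have e1 : expo1 (0, 0) = (0, 1) := by simp [expo1]
    rw [Function.extend_apply' _ _ _ fun ⟨k, hk⟩ => expo0_ne k (n := 0) (s := 0)
      (by simpa using hk),
      ← e1, expo1_injective.extend_apply, Pi.zero_apply, zero_add]
  · have e1 : expo1 (0, -1) = (0, -1) := by simp [expo1]
    rw [Function.extend_apply' _ _ _ fun ⟨k, hk⟩ => expo0_ne k (n := 0) (s := -1)
      (by simpa using hk), ← e1, expo1_injective.extend_apply, Pi.zero_apply, zero_add]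

/-! ### Derivatives of Fourier series -/

/-- On the strip |Im w| < M each term is bounded by the sum of its absolute values at iM and -iM, so
termwise differentiation is allowed. -/
lemma hasSum_deriv_fourier {ι : Type*} {a : ι → ℂ} {r : ι → ℤ} {F : ℂ → ℂ}
    (h : ∀ z, HasSum (fun i => a i * ex (r i * z)) (F z)) (z : ℂ) :
    HasSum (fun i => a i * (2 * π * Complex.I * r i) * ex (r i * z)) (deriv F z) := by
  let M : ℝ := |z.im| + 1
  have hU : IsOpen {w : ℂ | |w.im| < M} := isOpen_lt (by fun_prop) continuous_const
  have hz : z ∈ {w : ℂ | |w.im| < M} := by simp [M]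
  have hF : F = fun w => ∑' i, a i * ex (r i * w) := funext fun w => (h w).tsum_eq.symm
  have hd : ∀ i w, HasDerivAt (fun w => a i * ex (r i * w))
      (a i * (2 * π * Complex.I * r i) * ex (r i * w)) w := fun i w => by
    rw [mul_assoc]
    exact (hasDerivAt_ex_mul (r i) w).const_mul (a i)
  have hs := hasSum_deriv_of_summable_norm (F := fun i w => a i * ex (r i * w))
    (U := {w : ℂ | |w.im| < M})
    ((h (M * Complex.I)).summable.norm.add (h (-M * Complex.I)).summable.norm)
    (fun i w _ => (hd i w).differentiableAt.differentiableWithinAt) hU ?_ hz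
  · rw [hF]
    refine hs.congr_fun fun i => ?_
    rw [(hd i z).deriv]
  · intro i w hw
    have hw : |w.im| < M := hw
    have e : ∀ v : ℂ, ((r i : ℂ) * v).im = r i * v.im := fun v => by
      rw [← ofReal_intCast, im_ofReal_mul]
    simp only [norm_mul, norm_ex, e]
    rw [← mul_add]
    gcongr
    have e1 : ((M : ℂ) * Complex.I).im = M := by simp
    have e2 : (-(M : ℂ) * Complex.I).im = -M := by simp
    rw [e1, e2]
    rcases le_total 0 (r i : ℝ) with hr | hr
    · refine le_add_of_nonneg_of_le (Real.exp_pos _).le (Real.exp_le_exp.mpr ?_)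
      have := (abs_lt.mp hw).1
      nlinarith [mul_nonneg (mul_nonneg two_pos.le pi_pos.le)
        (mul_nonneg hr (by linarith : 0 ≤ w.im + M))]
    · refine le_add_of_le_of_nonneg (Real.exp_le_exp.mpr ?_) (Real.exp_pos _).le
      have := (abs_lt.mp hw).2
      nlinarith [mul_nonneg (mul_nonneg two_pos.le pi_pos.le)
        (mul_nonneg (neg_nonneg.mpr hr) (by linarith : 0 ≤ M - w.im))]

/-! ### Limits of weak Jacobi forms at the cusp -/

namespace WeakExpansion

variable {p : ℍ → ℂ → ℂ} {b : ℂ} {f : ℤ × ℤ → ℂ}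

lemma hasSum_second_deriv (h : WeakExpansion p b f) (τ : ℍ) :
    HasSum (fun i : ℤ × ℤ => f i * (2 * π * Complex.I * i.2) ^ 2 * ex (i.1 * τ))
      (deriv (deriv (p τ)) 0) := by
  have h0 : ∀ z, HasSum (fun i : ℤ × ℤ => f i * ex (i.1 * τ) * ex (i.2 * z)) (p τ z) := fun z =>
    (h.hasSum τ z).congr_fun fun i => by rw [ex_add, mul_assoc]
  refine (hasSum_deriv_fourier (hasSum_deriv_fourier h0) 0).congr_fun fun i => ?_
  rw [mul_zero, ex_zero]
  ring

lemma support_second (h : WeakExpansion p b f) (i : ℤ × ℤ)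
    (hi : f i * (2 * π * Complex.I * i.2) ^ 2 ≠ 0) : 0 ≤ i.1 :=
  (h.support i (left_ne_zero_of_mul hi)).1

lemma hol_second_deriv (h : WeakExpansion p b f) : Hol fun τ => deriv (deriv (p τ)) 0 :=
  hol_of_hasSum h.support_second h.hasSum_second_deriv

lemma T_smul_second_deriv (h : WeakExpansion p b f) (τ : ℍ) :
    deriv (deriv (p (T • τ))) 0 = deriv (deriv (p τ)) 0 :=
  T_smul_of_hasSum (F := fun τ => deriv (deriv (p τ)) 0) h.hasSum_second_deriv τ

/-- At q⁰ the support condition forces |r| ≤ 1, and the factor r² removes r = 0. What remains is 2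
(2πi)² b. -/
lemma tendsto_second_deriv (h : WeakExpansion p b f) :
    Tendsto (fun τ => deriv (deriv (p τ)) 0) atImInfty (𝓝 (-(8 * π ^ 2) * b)) := by
  have ht := tendsto_atImInfty_of_hasSum (F := fun τ => deriv (deriv (p τ)) 0)
    (r := fun i : ℤ × ℤ => (i.1 : ℝ)) (fun i hi => by exact_mod_cast h.support_second i hi)
    (by simpa using h.hasSum_second_deriv)
  convert! ht
  rw [tsum_eq_sum (s := {(0, 1), (0, -1)}) fun i hi => ?_]
  · rw [Finset.sum_pair (by simp)]
    simp only [Int.cast_zero, if_true, h.coeff_one, h.coeff_neg_one]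
    push_cast
    linear_combination (-(8 * π ^ 2) * b) * Complex.I_sq
  · split_ifs with h0
    · obtain ⟨n, r⟩ := i
      simp only [Int.cast_eq_zero] at h0
      subst h0
      by_cases hf : f (0, r) = 0
      · simp [hf]
      · have h1 := (h.support _ hf).2
        simp only [mul_zero, zero_sub, neg_le_neg_iff] at h1
        have h2 : |r| ≤ 1 := by
          rw [← sq_le_one_iff_abs_le_one]
          exact h1
        obtain ⟨h3, h4⟩ := abs_le.mp h2
        simp only [Finset.mem_insert, Finset.mem_singleton, Prod.mk.injEq, true_and] at hi
        obtain rfl : r = 0 := by omega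
        simp
    · rfl

/-- The term (n, r) acquires the exponent n - r/2 + 1/2 ≥ (r - 1)²/4, which is zero only at (0, 1).
This isolates the coefficient of ζ. -/
lemma tendsto_neg_half (h : WeakExpansion p b f) :
    Tendsto (fun τ : ℍ => ex (τ / 2) * p τ (-τ / 2)) atImInfty (𝓝 b) := by
  have key : ∀ i : ℤ × ℤ, f i ≠ 0 →
      ((i.2 : ℝ) - 1) ^ 2 / 4 ≤ (i.1 : ℝ) - i.2 / 2 + 1 / 2 := fun i hi => by
    have h1 := (h.support i hi).2
    have h2 : (-1 : ℝ) ≤ 4 * i.1 - i.2 ^ 2 := by exact_mod_cast h1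
    nlinarith
  have ht := tendsto_atImInfty_of_hasSum (F := fun τ : ℍ => ex (τ / 2) * p τ (-τ / 2))
    (r := fun i : ℤ × ℤ => (i.1 : ℝ) - i.2 / 2 + 1 / 2) (c := f)
    (fun i hi => le_trans (by positivity) (key i hi))
    (fun τ => ((h.hasSum τ (-τ / 2)).mul_left (ex (τ / 2))).congr_fun fun i => by
      rw [mul_left_comm, ← ex_add]
      congr 2
      push_cast
      ring)
  convert! ht
  rw [tsum_eq_single (0, 1) fun i hi => ?_]
  · rw [if_pos (by norm_num), h.coeff_one]
  · split_ifs with h0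
    · by_contra hf
      have h1 := key i hf
      rw [h0] at h1
      have h2 : ((i.2 : ℝ) - 1) ^ 2 = 0 := le_antisymm (by linarith) (sq_nonneg _)
      have h3 : (i.2 : ℝ) = 1 := by nlinarith [pow_eq_zero_iff (two_ne_zero) |>.mp h2]
      rw [h3] at h0
      have h4 : (i.1 : ℝ) = 0 := by linarith
      exact hi (Prod.ext (by exact_mod_cast h4) (by exact_mod_cast h3))
    · rfl

end WeakExpansion

/-! ### Taylor coefficients at z = 0 -/

namespace WeakJacobi

variable {p : ℍ → ℂ → ℂ} {k : ℤ}

lemma differentiable (h : WeakJacobi k p) (τ : ℍ) : Differentiable ℂ (p τ) := by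
  obtain ⟨g0, g1, hd, -⟩ := h.exists_decomp
  intro z
  have hmem : ((τ : ℂ), z) ∈ {q : ℂ × ℂ | 0 < q.1.im} := τ.2
  have ho : IsOpen {q : ℂ × ℂ | 0 < q.1.im} := isOpen_lt continuous_const (by fun_prop)
  have := (hd.differentiableOn.differentiableAt (ho.mem_nhds hmem)).comp z
    (f := fun z : ℂ => ((τ : ℂ), z)) (by fun_prop)
  refine this.congr_of_eventuallyEq (Eventually.of_forall fun w => ?_)
  simp

/-- Differentiating the transformation law twice: the scaling z/τ raises the weight by 2, and the
second derivative of e(z²/τ) at 0 produces the defect 4πi/τ · p(τ, 0). -/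
lemma second_deriv_S_smul (h : WeakJacobi k p) (τ : ℍ) :
    deriv (deriv (p (S • τ))) 0 = (τ : ℂ) ^ (k + 2) *
      (deriv (deriv (p τ)) 0 + 4 * π * Complex.I / τ * p τ 0) := by
  have h0 := τ.ne_zero
  have hL : ∀ q : ℂ → ℂ, deriv (deriv fun z => q (z / τ)) 0 =
      (τ : ℂ)⁻¹ ^ 2 * deriv (deriv q) 0 := by
    intro q
    have e : ∀ (q : ℂ → ℂ) (z : ℂ), deriv (fun z => q (z / τ)) z = (τ : ℂ)⁻¹ * deriv q (z / τ) := by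
      intro q z
      simp only [div_eq_inv_mul]
      rw [deriv_comp_mul_left, smul_eq_mul]
    rw [show (deriv fun z => q (z / τ)) = fun z => (τ : ℂ)⁻¹ * deriv q (z / τ) from funext (e q),
      deriv_const_mul_field, e, zero_div]
    ring
  have hp := h.differentiable τ
  have hp' : Differentiable ℂ (deriv (p τ)) := by
    have := hp.contDiff (n := 2)
    exact (contDiff_succ_iff_deriv (n := 1).mp this).2.2.differentiable (by norm_num)
  have hE : ∀ z : ℂ, HasDerivAt (fun z => ex (z ^ 2 / τ))
      (ex (z ^ 2 / τ) * (4 * π * Complex.I / τ * z)) z := fun z => by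
    have := ((((hasDerivAt_id z).pow 2).div_const (τ : ℂ)).const_mul (2 * π * Complex.I)).cexp
    unfold ex
    convert! this using 2
    simp
    ring
  have hR1 : ∀ z, HasDerivAt (fun z => ex (z ^ 2 / τ) * p τ z)
      (ex (z ^ 2 / τ) * (4 * π * Complex.I / τ * z * p τ z + deriv (p τ) z)) z := fun z => by
    convert! (hE z).mul (hp z).hasDerivAt using 1
    ring
  have hR2 : HasDerivAt (fun z => ex (z ^ 2 / τ) *
      (4 * π * Complex.I / τ * z * p τ z + deriv (p τ) z))
      (deriv (deriv (p τ)) 0 + 4 * π * Complex.I / τ * p τ 0) 0 := by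
    convert! (hE 0).mul ((((hasDerivAt_id (0 : ℂ)).const_mul (4 * π * Complex.I / (τ : ℂ))).mul
      (hp 0).hasDerivAt).add (hp' 0).hasDerivAt) using 1
    simp [ex_zero]
    ring
  have hfun : (fun z => p (S • τ) (z / τ)) =
      fun z => (τ : ℂ) ^ k * (ex (z ^ 2 / τ) * p τ z) := funext fun z => by
    rw [h.S_smul, mul_assoc]
  have hk := hL (p (S • τ))
  rw [hfun] at hk
  rw [show (deriv fun z => (τ : ℂ) ^ k * (ex (z ^ 2 / τ) * p τ z)) = fun z => (τ : ℂ) ^ k *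
    (ex (z ^ 2 / τ) * (4 * π * Complex.I / τ * z * p τ z + deriv (p τ) z)) from
      funext fun z => by rw [deriv_const_mul_field, (hR1 z).deriv],
    deriv_const_mul_field, hR2.deriv] at hk
  rw [zpow_add₀ h0, zpow_ofNat]
  field_simp at hk ⊢
  linear_combination -hk

/-- Vanishing at z = 0 kills the defect, so the second derivative is a modular form of weight 0; it
is constant and equals its limit at i∞. -/
lemma second_deriv_eq_of_weight_neg_two (h : WeakJacobi (-2) p) {b : ℂ} {f : ℤ × ℤ → ℂ}
    (hf : WeakExpansion p b f) (h0 : ∀ τ, p τ 0 = 0) (τ : ℍ) :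
    deriv (deriv (p τ)) 0 = -(8 * π ^ 2) * b := by
  obtain ⟨F, hF⟩ := exists_modularForm (k := 0) hf.hol_second_deriv
    (fun τ => by rw [h.second_deriv_S_smul, h0, mul_zero, add_zero]; norm_num)
    hf.T_smul_second_deriv (hf.tendsto_second_deriv.isBigO_one ℝ)
  obtain ⟨c, hc⟩ := ModularFormClass.levelOne_weight_zero_const F
  have h1 : ∀ τ, deriv (deriv (p τ)) 0 = c := fun τ => by rw [← hF, hc]; rfl
  have h2 := hf.tendsto_second_deriv
  simp only [h1] at h2
  rw [h1]
  exact tendsto_const_nhds_iff.mp h2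

lemma coeff_eq_of_weight_zero (h : WeakJacobi 0 p) {b : ℂ} {f : ℤ × ℤ → ℂ}
    (hf : WeakExpansion p b f) {C : ℂ} (h0 : ∀ τ, p τ 0 = C) : 12 * b = C := by
  -- The factor 2π²C/3 makes the anomaly -6iτ/π of E₂ cancel the defect 4πiτC. The sum is a modular
  -- form of weight 2, hence zero, and its limit at i∞ gives the relation.
  have ht := hf.tendsto_second_deriv.add (tendsto_E2.const_mul (2 * π ^ 2 * C / 3))
  obtain ⟨F, hF⟩ := exists_modularForm (k := 2)
    (f := fun τ => deriv (deriv (p τ)) 0 + 2 * π ^ 2 * C / 3 * EisensteinSeries.E2 τ)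
    (hf.hol_second_deriv.add ((hol_iff.mpr E2_mdifferentiable).const_mul _))
    (fun τ => by
      have := τ.ne_zero
      have hpi : (π : ℂ) ≠ 0 := ofReal_ne_zero.mpr pi_ne_zero
      rw [h.second_deriv_S_smul, h0, E2_S_smul, zero_add, zpow_ofNat]
      field_simp
      ring)
    (fun τ => by simp only [hf.T_smul_second_deriv, E2_T_smul]) (ht.isBigO_one ℝ)
  have hF0 : F = 0 := rank_zero_iff_forall_zero.mp ModularForm.levelOne_weight_two_rank_zero F
  have h1 : ∀ τ, deriv (deriv (p τ)) 0 + 2 * π ^ 2 * C / 3 * EisensteinSeries.E2 τ = 0 :=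
    fun τ => by rw [← hF, hF0]; rfl
  simp only [h1] at ht
  have h2 := tendsto_const_nhds_iff.mp ht
  have hpi : (π : ℂ) ≠ 0 := ofReal_ne_zero.mpr pi_ne_zero
  have h3 : (2 * (π : ℂ) ^ 2) * (12 * b - C) = 0 := by linear_combination 3 * h2
  exact sub_eq_zero.mp ((mul_eq_zero.mp h3).resolve_left (by simp [hpi]))

end WeakJacobi

/-! ### The square of the Jacobi theta series -/

lemma χ₄_two_mul (m : ℤ) : ZMod.χ₄ ((2 * m : ℤ) : ZMod 4) = 0 := by
  rw [ZMod.χ₄_int_eq_if_mod_four]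
  simp

lemma χ₄_two_mul_add_one (m : ℤ) : ((ZMod.χ₄ ((2 * m + 1 : ℤ) : ZMod 4) : ℤ) : ℂ) = (-1) ^ m := by
  rw [ZMod.χ₄_int_eq_if_mod_four]
  rcases Int.even_or_odd' m with ⟨k, rfl | rfl⟩
  · rw [if_neg (by omega), if_pos (by omega), zpow_mul]
    simp
  · rw [if_neg (by omega), if_neg (by omega), zpow_add₀ (by norm_num), zpow_mul]
    simp

/-- Only odd n = 2m + 1 contribute, with sign (-1)^m. The comparison with `jacobiTheta₂` supplies
summability. -/
lemma hasSum_theta (τ : ℍ) (z : ℂ) :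
    HasSum (fun m : ℤ => (-1) ^ m * ex (((m : ℂ) + 1 / 2) ^ 2 / 2 * τ + (m + 1 / 2) * z))
      (theta τ z) := by
  have h := (hasSum_jacobiTheta₂_term (z + τ / 2 + 1 / 2) τ.2).mul_left (ex (τ / 8 + z / 2))
  have h1 : HasSum (fun m : ℤ => (-1) ^ m * ex (((m : ℂ) + 1 / 2) ^ 2 / 2 * τ + (m + 1 / 2) * z))
      (ex (τ / 8 + z / 2) * jacobiTheta₂ (z + τ / 2 + 1 / 2) τ) := by
    refine h.congr_fun fun m => ?_
    rw [jacobiTheta₂_term, ← ex_half_mul_intCast, ex, ex, ex, ← Complex.exp_add, ← Complex.exp_add]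
    congr 1
    ring
  rw [theta, (hasSum_int_even_add_odd (a := 0) (hasSum_zero.congr_fun fun m => ?_)
    (h1.congr_fun fun m => ?_)).tsum_eq, zero_add]
  · exact h1
  · rw [χ₄_two_mul, Int.cast_zero, zero_mul]
  · rw [χ₄_two_mul_add_one, ex]
    congr 2
    push_cast
    ring

lemma hasSum_prod_parity {f : ℤ × ℤ → ℂ} {a b : ℂ}
    (ha : HasSum (fun i : ℤ × ℤ => f (i.1 + i.2, i.1 - i.2)) a)
    (hb : HasSum (fun i : ℤ × ℤ => f (i.1 + i.2, i.1 - i.2 - 1)) b) : HasSum f (a + b) := by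
  have h0 : Function.Injective (fun i : ℤ × ℤ => (i.1 + i.2, i.1 - i.2)) := by
    rintro ⟨m, n⟩ ⟨m', n'⟩ h
    simp only [Prod.mk.injEq] at h ⊢
    omega
  have h1 : Function.Injective (fun i : ℤ × ℤ => (i.1 + i.2, i.1 - i.2 - 1)) := by
    rintro ⟨m, n⟩ ⟨m', n'⟩ h
    simp only [Prod.mk.injEq] at h ⊢
    omega
  refine HasSum.add_isCompl (s := Set.range fun i : ℤ × ℤ => (i.1 + i.2, i.1 - i.2))
    (t := Set.range fun i : ℤ × ℤ => (i.1 + i.2, i.1 - i.2 - 1)) ?_ (h0.hasSum_range_iff.mpr ha)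
    (h1.hasSum_range_iff.mpr hb)
  constructor
  · rw [Set.disjoint_left]
    rintro _ ⟨⟨m, m'⟩, rfl⟩ ⟨⟨n, n'⟩, h⟩
    simp only [Prod.mk.injEq] at h
    omega
  · rw [codisjoint_iff, Set.top_eq_univ, Set.eq_univ_iff_forall]
    rintro ⟨m, n⟩
    rcases Int.even_or_odd' (m + n) with ⟨k, hk | hk⟩
    · refine Or.inl ⟨(k, m - k), ?_⟩
      simp only [Prod.mk.injEq]
      omega
    · refine Or.inr ⟨(k + 1, m - k - 1), ?_⟩
      simp only [Prod.mk.injEq]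
      omega

/-- In the double series over (m, n), put m = a + b and n = a - b when m + n is even: the exponent
of q becomes (a + 1/2)² + b², with sign +1. When m + n is odd, n = a - b - 1 gives a² + (b + 1/2)²,
with sign -1. -/
lemma theta_sq (τ : ℍ) (z : ℂ) :
    theta τ z ^ 2 = th0 τ 0 * th1 τ z - th1 τ 0 * th0 τ z := by
  have h := hasSum_mul_complex (hasSum_theta τ z) (hasSum_theta τ z)
  rw [pow_two]
  refine h.unique ?_
  rw [sub_eq_add_neg]
  refine hasSum_prod_parity ?_ ?_
  · rw [mul_comm]
    refine (hasSum_mul_complex (hasSum_th1 τ.2 z) (hasSum_th0 τ.2 0)).congr_fun fun i => ?_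
    rw [mul_mul_mul_comm, ← zpow_add₀ (by norm_num), ← ex_add, ← ex_add,
      show i.1 + i.2 + (i.1 - i.2) = 2 * i.1 by ring, zpow_mul]
    norm_num
    congr 1
    ring
  · rw [mul_comm]
    refine (hasSum_mul_complex (hasSum_th0 τ.2 z) (hasSum_th1 τ.2 0)).neg.congr_fun fun i => ?_
    rw [mul_mul_mul_comm, ← zpow_add₀ (by norm_num), ← ex_add, ← ex_add,
      show i.1 + i.2 + (i.1 - i.2 - 1) = 2 * (i.1 - 1) + 1 by ring, zpow_add₀ (by norm_num),
      zpow_mul]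
    norm_num
    congr 1
    ring

/-! ### The weak Jacobi form of weight `-2` -/

/-- `ϑ² / η⁶`. -/
def phiNegTwo (τ : ℍ) (z : ℂ) : ℂ := theta τ z ^ 2 / ModularForm.eta τ ^ 6

lemma th1_zero_T (τ : ℍ) : th1 ((T • τ : ℍ) : ℂ) 0 = Complex.I * th1 τ 0 := by
  rw [coe_T_smul, th1_add_one τ.2]

lemma th0_zero_T (τ : ℍ) : th0 ((T • τ : ℍ) : ℂ) 0 = th0 τ 0 := by
  rw [coe_T_smul, th0_add_one]

lemma phiNegTwo_decomp : ThetaDecomp phiNegTwo (fun τ => -th1 τ 0 / ModularForm.eta τ ^ 6)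
    (fun τ => th0 τ 0 / ModularForm.eta τ ^ 6) where
  eq τ z := by
    rw [phiNegTwo, theta_sq]
    ring
  hol0 := hol_th1_zero.neg.div (hol_eta.pow 6) fun τ => pow_ne_zero 6 (eta_ne_zero τ)
  hol1 := hol_th0_zero.div (hol_eta.pow 6) fun τ => pow_ne_zero 6 (eta_ne_zero τ)
  T0 τ := by
    rw [th1_zero_T, eta_pow_six_T_smul, ← mul_neg, mul_div_mul_left _ _ Complex.I_ne_zero]
  T1 τ := by
    rw [th0_zero_T, eta_pow_six_T_smul, ← div_div, ← mul_div_assoc]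
    congr 1
    rw [Complex.div_I]
    ring

lemma tendsto_th0_zero : Tendsto (fun τ : ℍ => th0 τ 0) atImInfty (𝓝 1) := by
  have h := tendsto_atImInfty_of_hasSum (F := fun τ : ℍ => th0 τ 0) (c := fun _ : ℤ => 1)
    (r := fun n : ℤ => (n : ℝ) ^ 2) (fun n _ => sq_nonneg _)
    (fun τ => (hasSum_th0 τ.2 0).congr_fun fun n => by
      simp)
  convert! h
  rw [tsum_eq_single 0 fun n hn => by simp [hn]]
  simp

lemma exists_tendsto_th1_zero :
    ∃ c, Tendsto (fun τ : ℍ => th1 τ 0 / ex (τ / 4)) atImInfty (𝓝 c) := by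
  refine ⟨_, tendsto_atImInfty_of_hasSum (F := fun τ : ℍ => th1 τ 0 / ex (τ / 4))
    (c := fun _ : ℤ => 1) (r := fun n : ℤ => (n : ℝ) ^ 2 + n) (fun n _ => ?_)
    (fun τ => ((hasSum_th1 τ.2 0).mul_right (ex (τ / 4))⁻¹).congr_fun fun n => ?_)⟩
  · have : 0 ≤ n ^ 2 + n := by
      rcases le_or_gt 0 n with h | h
      · positivity
      · nlinarith
    exact_mod_cast this
  · rw [one_mul, ← ex_sub]
    congr 1
    push_cast
    ring

lemma tendsto_eta_pow_six :
    Tendsto (fun τ : ℍ => ModularForm.eta τ ^ 6 / ex (τ / 4)) atImInfty (𝓝 1) := by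
  have h := tendsto_eta_div.pow 6
  rw [one_pow] at h
  refine h.congr fun τ => ?_
  rw [div_pow, ← ex_nsmul]
  congr 2
  push_cast
  ring

lemma tendsto_phiNegTwo_decomp1 :
    Tendsto (fun τ : ℍ => ex (τ / 4) * (th0 τ 0 / ModularForm.eta τ ^ 6)) atImInfty (𝓝 1) := by
  have h := tendsto_th0_zero.div tendsto_eta_pow_six one_ne_zero
  rw [div_one] at h
  refine h.congr fun τ => ?_
  have := ex_ne_zero (τ / 4)
  have := eta_ne_zero τ
  simp only [Pi.div_apply]
  field_simp

/-- Numerator and denominator are both q^(1/4) times a function with a finite limit, the latter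
limit being 1. -/
lemma isBounded_phiNegTwo_decomp0 :
    IsBoundedAtImInfty fun τ : ℍ => -th1 τ 0 / ModularForm.eta τ ^ 6 := by
  obtain ⟨c, hc⟩ := exists_tendsto_th1_zero
  have h := (hc.div tendsto_eta_pow_six one_ne_zero).neg
  refine Tendsto.isBigO_one ℝ (h.congr fun τ => ?_)
  have := ex_ne_zero (τ / 4)
  have := eta_ne_zero τ
  simp only [Pi.div_apply]
  field_simp

/-- By `theta_sq`, ϑ² is a 2 × 2 determinant in ϑ₀, ϑ₁. Up to the exponential, S multiplies it by -2
(sq τ)² = iτ, and η⁶ by iτ³; the quotient leaves τ⁻². -/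
lemma phiNegTwo_weakJacobi : WeakJacobi (-2) phiNegTwo where
  S_smul τ z := by
    have h0 := th0_S τ.2 z
    have h1 := th1_S τ.2 z
    have h2 := th0_S τ.2 0
    have h3 := th1_S τ.2 0
    have hs := sq_sq (τ := (τ : ℂ))
    rw [zero_div, zero_pow two_ne_zero, zero_div, ex_zero, mul_one] at h2 h3
    have hτ := τ.ne_zero
    have he := eta_ne_zero τ
    rw [phiNegTwo, theta_sq, eta_pow_six_S_smul, coe_S_smul, phiNegTwo, theta_sq]
    rw [h0, h1, h2, h3, zpow_neg, zpow_ofNat]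
    have hI := Complex.I_ne_zero
    field_simp
    linear_combination (2 * ex (z ^ 2 / τ.1) * (th1 τ.1 0 * th0 τ.1 z - th0 τ.1 0 * th1 τ.1 z)) * hs
  exists_decomp :=
    ⟨_, _, phiNegTwo_decomp, isBounded_phiNegTwo_decomp0,
      tendsto_phiNegTwo_decomp1.isBigO_one ℝ⟩

lemma phiNegTwo_weakExpansion : ∃ f, WeakExpansion phiNegTwo 1 f := by
  obtain ⟨b, f, hf, hb⟩ := phiNegTwo_decomp.exists_weakExpansion isBounded_phiNegTwo_decomp0
    (tendsto_phiNegTwo_decomp1.isBigO_one ℝ)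
  exact ⟨f, tendsto_nhds_unique hb tendsto_phiNegTwo_decomp1 ▸ hf⟩

lemma phiNegTwo_zero (τ : ℍ) : phiNegTwo τ 0 = 0 := by
  rw [phiNegTwo, theta_sq]
  ring

/-! ### The transformation of `ϑ₀` under the modular group -/

lemma hol_sq : Hol fun τ => sq τ := by
  refine hol_of_differentiableOn fun w hw => DifferentiableAt.differentiableWithinAt ?_
  have hw : 0 < w.im := hw
  -- The base -iw/2 has real part Im w / 2 > 0, so it lies in the slit plane.
  refine DifferentiableAt.cpow_const (by fun_prop) (Or.inl ?_)
  have : w / 2 = ((1 / 2 : ℝ) : ℂ) * w := by push_cast; ring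
  rw [this]
  simpa using hw

/-- The automorphy factor `c τ + d`. -/
def J (c d : ℤ) (τ : ℂ) : ℂ := c * τ + d

lemma J_ne_zero {c d : ℤ} (h : IsCoprime c d) (τ : ℍ) : J c d τ ≠ 0 := by
  have h0 : ![(c : ℝ), d] ≠ 0 := by
    intro h0
    have h1 := congrFun h0 0
    have h2 := congrFun h0 1
    simp at h1 h2
    rw [h1, h2] at h
    exact not_isCoprime_zero_zero h
  have := UpperHalfPlane.linear_ne_zero τ h0
  simpa [J] using this

lemma hol_J (c d : ℤ) : Hol fun τ => J c d τ :=
  hol_of_differentiableOn (f := J c d) (by unfold J; fun_prop)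

/-- `ϑ₀(γ τ, z / (c τ + d))` is a combination of `ϑ₀` and `ϑ₁` with holomorphic coefficients,
which form a vector of norm `|c τ + d| ^ (1/2)`. -/
def IsThetaRow (γ : SL(2, ℤ)) (A B : ℍ → ℂ) : Prop :=
  Hol A ∧ Hol B ∧ (∀ τ : ℍ, ‖A τ‖ ^ 2 + ‖B τ‖ ^ 2 = ‖J (γ 1 0) (γ 1 1) τ‖) ∧
    ∀ (τ : ℍ) (z : ℂ), th0 (γ • τ : ℍ) (z / J (γ 1 0) (γ 1 1) τ) =
      ex (γ 1 0 * z ^ 2 / J (γ 1 0) (γ 1 1) τ) * (A τ * th0 τ z + B τ * th1 τ z)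

lemma isCoprime_bottom_row (γ : SL(2, ℤ)) : IsCoprime (γ 1 0) (γ 1 1) := by
  have h := γ.det_coe
  rw [Matrix.det_fin_two] at h
  exact ⟨-γ 0 1, γ 0 0, by linear_combination h⟩

lemma isThetaRow_one : IsThetaRow 1 (fun _ => 1) (fun _ => 0) := by
  refine ⟨differentiableOn_const _, differentiableOn_const _, fun τ => ?_, fun τ z => ?_⟩
  · simp [J]
  · simp [J, ex_zero]

lemma IsThetaRow.neg {γ : SL(2, ℤ)} {A B : ℍ → ℂ} (h : IsThetaRow γ A B) :
    IsThetaRow (-γ) A B := by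
  obtain ⟨hA, hB, hn, hth⟩ := h
  have e : ∀ i j, (-γ) i j = -γ i j := fun i j => by simp
  have eJ : ∀ τ, J (-γ 1 0) (-γ 1 1) τ = -J (γ 1 0) (γ 1 1) τ := fun τ => by
    simp only [J]
    push_cast
    ring
  refine ⟨hA, hB, fun τ => ?_, fun τ z => ?_⟩
  · rw [e, e, eJ, norm_neg, hn]
  · rw [e, e, eJ, div_neg, th0_neg, ModularGroup.SL_neg_smul, hth]
    congr 2
    push_cast
    rw [neg_mul, neg_div_neg_eq]

/-- S acts on (ϑ₀, ϑ₁) through sq τ times the matrix with rows (1, 1) and (1, -1). The norm identity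
follows from the parallelogram law and |sq τ|² = |τ|/2. -/
lemma IsThetaRow.mul_S {γ : SL(2, ℤ)} {A B : ℍ → ℂ} (h : IsThetaRow γ A B) :
    IsThetaRow (γ * S) (fun τ => sq τ * (A (S • τ) + B (S • τ)))
      (fun τ => sq τ * (A (S • τ) - B (S • τ))) := by
  obtain ⟨hA, hB, hn, hth⟩ := h
  have e0 : (γ * S) 1 0 = γ 1 1 := by
    simp [ModularGroup.coe_S, Matrix.mul_apply, Fin.sum_univ_two]
  have e1 : (γ * S) 1 1 = -γ 1 0 := by
    simp [ModularGroup.coe_S, Matrix.mul_apply, Fin.sum_univ_two]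
  have eJ : ∀ τ : ℍ, J (γ 1 1) (-γ 1 0) τ = τ * J (γ 1 0) (γ 1 1) (S • τ : ℍ) := fun τ => by
    have := τ.ne_zero
    rw [coe_S_smul]
    simp only [J]
    push_cast
    field_simp
    ring
  refine ⟨hol_sq.mul ((hA.smul_comp S).add (hB.smul_comp S)),
    hol_sq.mul ((hA.smul_comp S).sub (hB.smul_comp S)), fun τ => ?_, fun τ z => ?_⟩
  · have h2 : ‖sq τ‖ ^ 2 = ‖(τ : ℂ)‖ / 2 := by
      rw [← norm_pow, sq_sq]
      simp
    have h3 := parallelogram_law_with_norm ℝ (A (S • τ)) (B (S • τ))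
    rw [e0, e1, eJ]
    simp only [norm_mul, mul_pow, h2, ← hn]
    linear_combination ‖(τ : ℂ)‖ / 2 * h3
  · have hJ : J (γ 1 0) (γ 1 1) (S • τ : ℍ) ≠ 0 := J_ne_zero (isCoprime_bottom_row γ) _
    have hτ := τ.ne_zero
    have hJ' : J (γ 1 1) (-γ 1 0) τ ≠ 0 := by
      rw [eJ]
      exact mul_ne_zero hτ hJ
    have hz : z / J (γ 1 1) (-γ 1 0) τ = (z / τ) / J (γ 1 0) (γ 1 1) (S • τ : ℍ) := by
      rw [eJ, div_div]
    have hexp : (γ 1 1 : ℂ) * z ^ 2 / J (γ 1 1) (-γ 1 0) τ =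
        γ 1 0 * (z / τ) ^ 2 / J (γ 1 0) (γ 1 1) (S • τ : ℍ) + z ^ 2 / τ := by
      have h5 : J (γ 1 0) (γ 1 1) (S • τ : ℍ) = J (γ 1 1) (-γ 1 0) τ / τ := by
        rw [eJ, mul_div_cancel_left₀ _ hτ]
      rw [h5]
      field_simp
      simp only [J]
      push_cast
      ring
    rw [e0, e1, mul_smul, hz, hth, hexp, ex_add, coe_S_smul, th0_S τ.2, th1_S τ.2]
    ring

lemma IsThetaRow.mul_T {γ : SL(2, ℤ)} {A B : ℍ → ℂ} (h : IsThetaRow γ A B) :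
    IsThetaRow (γ * T) (fun τ => A (T • τ)) (fun τ => Complex.I * B (T • τ)) := by
  obtain ⟨hA, hB, hn, hth⟩ := h
  have e0 : (γ * T) 1 0 = γ 1 0 := by
    simp [ModularGroup.coe_T, Matrix.mul_apply, Fin.sum_univ_two]
  have e1 : (γ * T) 1 1 = γ 1 0 + γ 1 1 := by
    simp [ModularGroup.coe_T, Matrix.mul_apply, Fin.sum_univ_two]
  have eJ : ∀ τ : ℍ, J (γ 1 0) (γ 1 0 + γ 1 1) τ = J (γ 1 0) (γ 1 1) (T • τ : ℍ) := fun τ => by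
    rw [coe_T_smul]
    simp only [J]
    push_cast
    ring
  refine ⟨hA.smul_comp T, (hB.smul_comp T).const_mul _, fun τ => ?_, fun τ z => ?_⟩
  · rw [e0, e1, eJ, ← hn, norm_mul, Complex.norm_I, one_mul]
  · rw [e0, e1, eJ, mul_smul, hth, coe_T_smul, th0_add_one, th1_add_one τ.2]
    ring

lemma coe_T_inv_smul (τ : ℍ) : ((T⁻¹ • τ : ℍ) : ℂ) = τ - 1 := by
  have h := coe_T_smul (T⁻¹ • τ)
  rw [smul_inv_smul] at h
  rw [h, add_sub_cancel_right]

lemma IsThetaRow.mul_T_inv {γ : SL(2, ℤ)} {A B : ℍ → ℂ} (h : IsThetaRow γ A B) :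
    IsThetaRow (γ * T⁻¹) (fun τ => A (T⁻¹ • τ)) (fun τ => -Complex.I * B (T⁻¹ • τ)) := by
  obtain ⟨hA, hB, hn, hth⟩ := h
  have e0 : (γ * T⁻¹) 1 0 = γ 1 0 := by
    simp [Matrix.mul_apply, Fin.sum_univ_two]
  have e1 : (γ * T⁻¹) 1 1 = -γ 1 0 + γ 1 1 := by
    simp [Matrix.mul_apply, Fin.sum_univ_two]
  have eJ : ∀ τ : ℍ, J (γ 1 0) (-γ 1 0 + γ 1 1) τ = J (γ 1 0) (γ 1 1) (T⁻¹ • τ : ℍ) := fun τ => by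
    rw [coe_T_inv_smul]
    simp only [J]
    push_cast
    ring
  refine ⟨hA.smul_comp _, (hB.smul_comp _).const_mul _, fun τ => ?_, fun τ z => ?_⟩
  · rw [e0, e1, eJ, ← hn, norm_mul, norm_neg, Complex.norm_I, one_mul]
  · have h1 := th1_add_one (T⁻¹ • τ).2 z
    have h0 := th0_add_one ((T⁻¹ • τ : ℍ) : ℂ) z
    have hc := coe_T_inv_smul τ
    rw [hc, sub_add_cancel] at h0 h1
    rw [e0, e1, eJ, mul_smul, hth]
    rw [hc, ← h0, h1]
    linear_combination (ex (γ 1 0 * z ^ 2 / J (γ 1 0) (γ 1 1) (τ - 1)) * B (T⁻¹ • τ) *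
      th1 (τ - 1) z) * Complex.I_mul_I

/-- Induction on a word in S and T. Since S⁻¹ = -S, the inverse of S is covered by the evenness of
ϑ₀. -/
lemma exists_isThetaRow (γ : SL(2, ℤ)) : ∃ A B, IsThetaRow γ A B := by
  have hγ : γ ∈ Subgroup.closure {S, T} := by
    rw [SpecialLinearGroup.SL2Z_generators]
    trivial
  induction hγ using Subgroup.closure_induction_right with
  | one => exact ⟨_, _, isThetaRow_one⟩
  | mul_right x _ y hy ih =>
    obtain ⟨A, B, h⟩ := ih
    rcases hy with rfl | rfl
    · exact ⟨_, _, h.mul_S⟩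
    · exact ⟨_, _, h.mul_T⟩
  | mul_inv_cancel x _ y hy ih =>
    obtain ⟨A, B, h⟩ := ih
    rcases hy with rfl | rfl
    · have hS : x * S⁻¹ = -(x * S) := by rw [ModularGroup.S_inv, mul_neg]
      rw [hS]
      exact ⟨_, _, h.mul_S.neg⟩
    · exact ⟨_, _, h.mul_T_inv⟩

/-! ### The Jacobi-Eisenstein series -/

lemma coe_smul_eq (γ : SL(2, ℤ)) (τ : ℍ) :
    ((γ • τ : ℍ) : ℂ) = ((γ 0 0 : ℂ) * τ + γ 0 1) / J (γ 1 0) (γ 1 1) τ := by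
  rw [UpperHalfPlane.coe_specialLinearGroup_apply]
  simp [J]

lemma J_mul (γ δ : SL(2, ℤ)) (τ : ℍ) :
    J ((γ * δ) 1 0) ((γ * δ) 1 1) τ =
      J (γ 1 0) (γ 1 1) (δ • τ : ℍ) * J (δ 1 0) (δ 1 1) τ := by
  have hδ : J (δ 1 0) (δ 1 1) τ ≠ 0 := J_ne_zero (isCoprime_bottom_row δ) τ
  have e0 : (γ * δ) 1 0 = γ 1 0 * δ 0 0 + γ 1 1 * δ 1 0 := by
    simp [Matrix.mul_apply, Fin.sum_univ_two]
  have e1 : (γ * δ) 1 1 = γ 1 0 * δ 0 1 + γ 1 1 * δ 1 1 := by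
    simp [Matrix.mul_apply, Fin.sum_univ_two]
  rw [coe_smul_eq, e0, e1]
  conv_rhs => rw [J]
  field_simp
  simp only [J]
  push_cast
  ring

/-- The contribution of `γ` to the Jacobi-Eisenstein series of weight `k`. -/
def eisTerm (k : ℕ) (γ : SL(2, ℤ)) (τ : ℍ) (z : ℂ) : ℂ :=
  J (γ 1 0) (γ 1 1) τ ^ (-(k : ℤ)) *
    (ex (-(γ 1 0 * z ^ 2 / J (γ 1 0) (γ 1 1) τ)) * th0 (γ • τ : ℍ) (z / J (γ 1 0) (γ 1 1) τ))

lemma coe_smul_add_int_of_bottom_row_eq {γ γ' : SL(2, ℤ)} (h0 : γ 1 0 = γ' 1 0)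
    (h1 : γ 1 1 = γ' 1 1) (τ : ℍ) : ∃ n : ℤ, ((γ' • τ : ℍ) : ℂ) = (γ • τ : ℍ) + n := by
  have d := γ.det_coe
  have d' := γ'.det_coe
  rw [Matrix.det_fin_two] at d d'
  have hJ : J (γ 1 0) (γ 1 1) τ ≠ 0 := J_ne_zero (isCoprime_bottom_row γ) τ
  refine ⟨γ 0 0 * γ' 0 1 - γ' 0 0 * γ 0 1, ?_⟩
  rw [coe_smul_eq, coe_smul_eq, ← h0, ← h1, div_add' _ _ _ hJ]
  congr 1
  rw [← h0, ← h1] at d'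
  have d : (γ 0 0 : ℂ) * γ 1 1 - γ 0 1 * γ 1 0 = 1 := by exact_mod_cast d
  have d' : (γ' 0 0 : ℂ) * γ 1 1 - γ' 0 1 * γ 1 0 = 1 := by exact_mod_cast d'
  simp only [J]
  push_cast
  linear_combination (-(γ' 0 0 : ℂ) * τ - γ' 0 1) * d + ((γ 0 0 : ℂ) * τ + γ 0 1) * d'

/-- Equal bottom rows mean that γτ and γ'τ differ by an integer, and ϑ₀ has period 1 in τ. So the
term does not depend on the choice of a and b. -/
lemma eisTerm_congr (k : ℕ) {γ γ' : SL(2, ℤ)} (h0 : γ 1 0 = γ' 1 0) (h1 : γ 1 1 = γ' 1 1)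
    (τ : ℍ) (z : ℂ) : eisTerm k γ τ z = eisTerm k γ' τ z := by
  obtain ⟨n, hn⟩ := coe_smul_add_int_of_bottom_row_eq h0 h1 τ
  simp only [eisTerm, ← h0, ← h1, hn, th0_add_int]

/-- The cocycle relation for c/(cτ + d), which makes the exponential factors of index 1 compatible
with products. -/
lemma index_cocycle (γ δ : SL(2, ℤ)) (τ : ℍ) (w : ℂ) :
    (((γ * δ) 1 0 : ℤ) : ℂ) * w / (J (γ 1 0) (γ 1 1) (δ • τ : ℍ) * J (δ 1 0) (δ 1 1) τ) =
      δ 1 0 * w / J (δ 1 0) (δ 1 1) τ +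
        γ 1 0 * (w / J (δ 1 0) (δ 1 1) τ ^ 2) / J (γ 1 0) (γ 1 1) (δ • τ : ℍ) := by
  have hδ : J (δ 1 0) (δ 1 1) τ ≠ 0 := J_ne_zero (isCoprime_bottom_row δ) τ
  have hγ : J (γ 1 0) (γ 1 1) (δ • τ : ℍ) ≠ 0 := J_ne_zero (isCoprime_bottom_row γ) _
  have e0 : (γ * δ) 1 0 = γ 1 0 * δ 0 0 + γ 1 1 * δ 1 0 := by
    simp [Matrix.mul_apply, Fin.sum_univ_two]
  have d := δ.det_coe
  rw [Matrix.det_fin_two] at d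
  have d : (δ 0 0 : ℂ) * δ 1 1 - δ 0 1 * δ 1 0 = 1 := by exact_mod_cast d
  have h2 : (γ 1 0 : ℂ) + J (γ 1 0) (γ 1 1) (δ • τ : ℍ) * δ 1 0 * J (δ 1 0) (δ 1 1) τ =
      (γ 1 0 * δ 0 0 + γ 1 1 * δ 1 0) * J (δ 1 0) (δ 1 1) τ := by
    conv_lhs => rw [J, coe_smul_eq]
    field_simp
    simp only [J]
    linear_combination (-(γ 1 0 : ℂ)) * d
  rw [e0]
  push_cast
  field_simp
  linear_combination (-w) * h2

lemma eisTerm_smul (k : ℕ) (γ δ : SL(2, ℤ)) (τ : ℍ) (z : ℂ) :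
    eisTerm k γ (δ • τ) (z / J (δ 1 0) (δ 1 1) τ) =
      J (δ 1 0) (δ 1 1) τ ^ k * ex (δ 1 0 * z ^ 2 / J (δ 1 0) (δ 1 1) τ) *
        eisTerm k (γ * δ) τ z := by
  have hδ : J (δ 1 0) (δ 1 1) τ ≠ 0 := J_ne_zero (isCoprime_bottom_row δ) τ
  have hexp : -((((γ * δ) 1 0 : ℤ) : ℂ) * z ^ 2 /
      (J (γ 1 0) (γ 1 1) (δ • τ : ℍ) * J (δ 1 0) (δ 1 1) τ)) =
      -(δ 1 0 * z ^ 2 / J (δ 1 0) (δ 1 1) τ) + -(γ 1 0 * (z / J (δ 1 0) (δ 1 1) τ) ^ 2 /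
        J (γ 1 0) (γ 1 1) (δ • τ : ℍ)) := by
    rw [index_cocycle, div_pow, neg_add]
  simp only [eisTerm]
  rw [J_mul, mul_smul, hexp, ex_add, ← div_div, div_right_comm z, mul_zpow,
    zpow_neg (J (δ 1 0) _ _),
    zpow_natCast, ex_neg (δ 1 0 * z ^ 2 / _)]
  have := ex_ne_zero (δ 1 0 * z ^ 2 / J (δ 1 0) (δ 1 1) τ)
  generalize ex (δ 1 0 * z ^ 2 / J (δ 1 0) (δ 1 1) τ) = E at this ⊢
  field_simp

/-- Coprime pairs of integers. -/
abbrev CoprimePair : Type := {p : ℤ × ℤ // IsCoprime p.1 p.2}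

/-- The matrix with bottom row `(c, d)` used in the definition of the Jacobi-Eisenstein series. -/
def cosetRep (p : CoprimePair) : SL(2, ℤ) :=
  ⟨!![Int.gcdB p.1.1 p.1.2, -Int.gcdA p.1.1 p.1.2; p.1.1, p.1.2], by
    have h := Int.gcd_eq_gcd_ab p.1.1 p.1.2
    rw [Int.isCoprime_iff_gcd_eq_one.mp p.2] at h
    rw [Matrix.det_fin_two_of]
    push_cast at h
    linear_combination -h⟩

@[simp] lemma cosetRep_one_zero (p : CoprimePair) : cosetRep p 1 0 = p.1.1 := rfl
@[simp] lemma cosetRep_one_one (p : CoprimePair) : cosetRep p 1 1 = p.1.2 := rfl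
lemma cosetRep_zero_zero (p : CoprimePair) : cosetRep p 0 0 = Int.gcdB p.1.1 p.1.2 := rfl
lemma cosetRep_zero_one (p : CoprimePair) : cosetRep p 0 1 = -Int.gcdA p.1.1 p.1.2 := rfl

lemma jacobiEisenstein_eq_tsum (k : ℕ) (τ : ℍ) (z : ℂ) :
    jacobiEisenstein k τ z = 1 / 2 * ∑' p : CoprimePair, eisTerm k (cosetRep p) τ z := by
  rw [jacobiEisenstein]
  congr 1
  refine tsum_congr fun p => ?_
  rw [tsum_mul_left]
  simp only [eisTerm]
  congr 1
  refine HasSum.tsum_eq (((hasSum_th0 (cosetRep p • τ).2 _).mul_left _).congr_fun fun m => ?_)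
  rw [← ex_add, coe_smul_eq, cosetRep_zero_zero, cosetRep_zero_one]
  simp only [ex, J, cosetRep_one_zero, cosetRep_one_one]
  congr 2
  push_cast
  ring

/-- The bottom row of a matrix in `SL(2, ℤ)`. -/
def bottomRow (γ : SL(2, ℤ)) : CoprimePair := ⟨(γ 1 0, γ 1 1), isCoprime_bottom_row γ⟩

lemma bottomRow_mul_cancel (δ ε : SL(2, ℤ)) (h : δ * ε = 1) (p : CoprimePair) :
    bottomRow (cosetRep (bottomRow (cosetRep p * δ)) * ε) = p := by
  have hcong : ∀ γ γ' : SL(2, ℤ), bottomRow γ = bottomRow γ' →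
      bottomRow (γ * ε) = bottomRow (γ' * ε) := fun γ γ' hγ => by
    have h0 : γ 1 0 = γ' 1 0 := congrArg (fun q : CoprimePair => q.1.1) hγ
    have h1 : γ 1 1 = γ' 1 1 := congrArg (fun q : CoprimePair => q.1.2) hγ
    refine Subtype.ext (Prod.ext ?_ ?_) <;>
      simp [bottomRow, Matrix.mul_apply, Fin.sum_univ_two, h0, h1]
  rw [hcong (cosetRep (bottomRow (cosetRep p * δ))) (cosetRep p * δ) rfl, mul_assoc, h, mul_one]
  rfl

/-- The action of `SL(2, ℤ)` on coprime pairs from the right. -/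
def coprimePairEquiv (δ : SL(2, ℤ)) : CoprimePair ≃ CoprimePair where
  toFun p := bottomRow (cosetRep p * δ)
  invFun p := bottomRow (cosetRep p * δ⁻¹)
  left_inv := bottomRow_mul_cancel δ δ⁻¹ (mul_inv_cancel δ)
  right_inv := bottomRow_mul_cancel δ⁻¹ δ (inv_mul_cancel δ)

/-- Right multiplication by δ permutes the bottom rows, hence the terms of the sum. -/
lemma jacobiEisenstein_smul (k : ℕ) (δ : SL(2, ℤ)) (τ : ℍ) (z : ℂ) :
    jacobiEisenstein k (δ • τ) (z / J (δ 1 0) (δ 1 1) τ) =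
      J (δ 1 0) (δ 1 1) τ ^ k * ex (δ 1 0 * z ^ 2 / J (δ 1 0) (δ 1 1) τ) *
        jacobiEisenstein k τ z := by
  rw [jacobiEisenstein_eq_tsum, jacobiEisenstein_eq_tsum]
  simp only [eisTerm_smul]
  rw [tsum_mul_left, ← (coprimePairEquiv δ).tsum_eq fun p => eisTerm k (cosetRep p) τ z]
  have : ∀ p, eisTerm k (cosetRep p * δ) τ z = eisTerm k (cosetRep (coprimePairEquiv δ p)) τ z :=
    fun p => eisTerm_congr k (cosetRep_one_zero (bottomRow (cosetRep p * δ))).symm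
      (cosetRep_one_one (bottomRow (cosetRep p * δ))).symm τ z
  simp only [this]
  ring

lemma jacobiEisenstein_S_smul (k : ℕ) (τ : ℍ) (z : ℂ) :
    jacobiEisenstein k (S • τ) (z / τ) =
      (τ : ℂ) ^ k * ex (z ^ 2 / τ) * jacobiEisenstein k τ z := by
  have h := jacobiEisenstein_smul k S τ z
  have h0 : S 1 0 = 1 := rfl
  have h1 : S 1 1 = 0 := rfl
  simpa [J, h0, h1] using h

lemma jacobiEisenstein_T_smul (k : ℕ) (τ : ℍ) (z : ℂ) :
    jacobiEisenstein k (T • τ) z = jacobiEisenstein k τ z := by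
  have h := jacobiEisenstein_smul k T τ z
  have h0 : T 1 0 = 0 := rfl
  have h1 : T 1 1 = 1 := rfl
  simpa [J, h0, h1, ex_zero] using h

/-! ### Its theta decomposition -/

/-- The coefficient of `ϑ₀` in the theta transformation formula for `γ`. -/
def rowA (γ : SL(2, ℤ)) : ℍ → ℂ := (exists_isThetaRow γ).choose

/-- The coefficient of `ϑ₁` in the theta transformation formula for `γ`. -/
def rowB (γ : SL(2, ℤ)) : ℍ → ℂ := (exists_isThetaRow γ).choose_spec.choose

lemma isThetaRow (γ : SL(2, ℤ)) : IsThetaRow γ (rowA γ) (rowB γ) :=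
  (exists_isThetaRow γ).choose_spec.choose_spec

lemma eisTerm_eq (k : ℕ) (γ : SL(2, ℤ)) (τ : ℍ) (z : ℂ) :
    eisTerm k γ τ z = J (γ 1 0) (γ 1 1) τ ^ (-(k : ℤ)) * rowA γ τ * th0 τ z +
      J (γ 1 0) (γ 1 1) τ ^ (-(k : ℤ)) * rowB γ τ * th1 τ z := by
  rw [eisTerm, (isThetaRow γ).2.2.2, ex_neg, inv_mul_cancel_left₀ (ex_ne_zero _)]
  ring

/-- Such γ is ± a power of T, which fixes ϑ₀; linear independence then identifies the coefficients.
-/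
lemma rowA_rowB_of_zero {γ : SL(2, ℤ)} (h : γ 1 0 = 0) (τ : ℍ) : rowA γ τ = 1 ∧ rowB γ τ = 0 := by
  have hd := γ.det_coe
  rw [Matrix.det_fin_two, h, mul_zero, sub_zero] at hd
  have hs : (γ 0 0 = 1 ∧ γ 1 1 = 1) ∨ (γ 0 0 = -1 ∧ γ 1 1 = -1) :=
    Int.mul_eq_one_iff_eq_one_or_neg_one.mp hd
  refine th_linearIndependent τ.2 fun z => ?_
  have hth := (isThetaRow γ).2.2.2 τ z
  simp only [h, J, Int.cast_zero, zero_mul, zero_div, ex_zero, one_mul, zero_add] at hth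
  rw [← hth, one_mul, zero_mul, add_zero, coe_smul_eq]
  rcases hs with ⟨h0, h1⟩ | ⟨h0, h1⟩
  · simp only [h0, h, h1, J, Int.cast_zero, Int.cast_one, zero_mul, zero_add, div_one, one_mul]
    rw [th0_add_int]
  · simp only [h0, h, h1, J, Int.cast_zero, Int.cast_one, Int.cast_neg, zero_mul, zero_add, div_one,
      div_neg, th0_neg]
    rw [show -(-1 * (τ : ℂ) + γ 0 1) = τ + ((-γ 0 1 : ℤ) : ℂ) by push_cast; ring, th0_add_int]

/-- A family of holomorphic functions indexed by coprime pairs, bounded by `|c τ + d| ^ (1/2)`. -/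
def IsRowFamily (A : CoprimePair → ℍ → ℂ) : Prop :=
  ∀ p, Hol (A p) ∧ ∀ τ : ℍ, ‖A p τ‖ ^ 2 ≤ ‖J p.1.1 p.1.2 τ‖

lemma isRowFamily_rowA : IsRowFamily fun p => rowA (cosetRep p) := fun p =>
  ⟨(isThetaRow _).1, fun τ => by
    have := (isThetaRow (cosetRep p)).2.2.1 τ
    rw [cosetRep_one_zero, cosetRep_one_one] at this
    nlinarith [sq_nonneg ‖rowB (cosetRep p) τ‖]⟩

lemma isRowFamily_rowB : IsRowFamily fun p => rowB (cosetRep p) := fun p =>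
  ⟨(isThetaRow _).2.1, fun τ => by
    have := (isThetaRow (cosetRep p)).2.2.1 τ
    rw [cosetRep_one_zero, cosetRep_one_one] at this
    nlinarith [sq_nonneg ‖rowA (cosetRep p) τ‖]⟩

lemma IsRowFamily.norm_le {A : CoprimePair → ℍ → ℂ} (hA : IsRowFamily A) (k : ℕ) (p : CoprimePair)
    (τ : ℍ) : ‖J p.1.1 p.1.2 τ ^ (-(k : ℤ)) * A p τ‖ ≤
      ‖J p.1.1 p.1.2 τ‖ ^ (-((k : ℝ) - 1 / 2)) := by
  have hJ : 0 < ‖J p.1.1 p.1.2 τ‖ := norm_pos_iff.mpr (J_ne_zero p.2 τ)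
  have h1 : ‖A p τ‖ ≤ ‖J p.1.1 p.1.2 τ‖ ^ (1 / 2 : ℝ) := by
    rw [← Real.sqrt_eq_rpow]
    exact Real.le_sqrt_of_sq_le ((hA p).2 τ)
  rw [norm_mul, norm_zpow, ← Real.rpow_intCast, neg_sub, sub_eq_add_neg, add_comm,
    Real.rpow_add hJ]
  push_cast
  gcongr

lemma summable_coprimePair {r : ℝ} (hr : 2 < r) :
    Summable fun p : CoprimePair => ‖(![p.1.1, p.1.2] : Fin 2 → ℤ)‖ ^ (-r) := by
  refine (EisensteinSeries.summable_one_div_norm_rpow hr).comp_injective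
    (i := fun p : CoprimePair => ![p.1.1, p.1.2]) fun p q h => ?_
  have h0 := congrFun h 0
  have h1 := congrFun h 1
  exact Subtype.ext (Prod.ext h0 h1)

/-- The terms are at most |cτ + d|^(-(k - 1/2)), and k ≥ 3 gives k - 1/2 > 2, the range of
convergence for sums over pairs (c, d). -/
lemma IsRowFamily.norm_le_of_mem_verticalStrip {A : CoprimePair → ℍ → ℂ} (hA : IsRowFamily A)
    {k : ℕ} (hk : 3 ≤ k) {a b : ℝ} (hb : 0 < b) : ∃ u : CoprimePair → ℝ, Summable u ∧
      ∀ τ ∈ verticalStrip a b, ∀ p, ‖J p.1.1 p.1.2 τ ^ (-(k : ℤ)) * A p τ‖ ≤ u p := by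
  have hk' : (3 : ℝ) ≤ k := by exact_mod_cast hk
  refine ⟨_, (summable_coprimePair (r := k - 1 / 2) (by linarith)).mul_left
    (EisensteinSeries.r ⟨⟨a, b⟩, hb⟩ ^ (-((k : ℝ) - 1 / 2))), fun τ hτ p => ?_⟩
  refine (hA.norm_le k p τ).trans ?_
  have := EisensteinSeries.summand_bound_of_mem_verticalStrip (k := (k : ℝ) - 1 / 2) (by linarith)
    ![p.1.1, p.1.2] hb hτ
  simpa [J] using this

lemma IsRowFamily.summable {A : CoprimePair → ℍ → ℂ} (hA : IsRowFamily A) {k : ℕ} (hk : 3 ≤ k)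
    (τ : ℍ) : Summable fun p => J p.1.1 p.1.2 τ ^ (-(k : ℤ)) * A p τ := by
  obtain ⟨u, hu, h⟩ := hA.norm_le_of_mem_verticalStrip hk (a := |τ.re|) τ.im_pos
  exact Summable.of_norm_bounded hu (h τ ⟨le_rfl, le_rfl⟩)

lemma IsRowFamily.hol_tsum {A : CoprimePair → ℍ → ℂ} (hA : IsRowFamily A) {k : ℕ} (hk : 3 ≤ k) :
    Hol fun τ => ∑' p, J p.1.1 p.1.2 τ ^ (-(k : ℤ)) * A p τ := by
  intro w hw
  have hw : 0 < w.im := hw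
  set U : Set ℂ := {v | |v.re| < |w.re| + 1 ∧ w.im / 2 < v.im} with hU
  have hUo : IsOpen U := by
    rw [hU, Set.ofPred_and]
    exact (isOpen_lt (by fun_prop) (by fun_prop)).inter (isOpen_lt (by fun_prop) (by fun_prop))
  have hwU : w ∈ U := ⟨by linarith, by linarith⟩
  have hUpos : U ⊆ {v | 0 < v.im} := fun v hv => by
    have := hv.2
    show 0 < v.im
    linarith
  obtain ⟨u, hu, h⟩ := hA.norm_le_of_mem_verticalStrip hk (a := |w.re| + 1) (b := w.im / 2)
    (by linarith)
  refine DifferentiableAt.differentiableWithinAt (DifferentiableOn.differentiableAt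
    (Complex.differentiableOn_tsum_of_summable_norm hu (fun p => ?_) hUo fun p v hv => ?_)
    (hUo.mem_nhds hwU))
  · have h1 : Hol fun τ => J p.1.1 p.1.2 τ ^ (-(k : ℤ)) := by
      have h2 : Hol fun τ => 1 / J p.1.1 p.1.2 τ ^ k :=
        (Hol.div (differentiableOn_const 1) ((hol_J p.1.1 p.1.2).pow k)
          fun τ => pow_ne_zero _ (J_ne_zero p.2 τ))
      refine h2.congr fun v _ => ?_
      simp
    exact (h1.mul (hA p).1).mono hUpos
  · refine h _ ?_ p
    rw [ofComplex_apply_of_im_pos (hUpos hv)]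
    exact ⟨hv.1.le, hv.2.le⟩

/-- An integer translation moves any τ to |Re τ| ≤ 1/2 without changing Im τ. The uniform bounds on
Eisenstein terms hold only in such strips. -/
lemma tendsto_atImInfty_of_strip {X : Type*} [TopologicalSpace X] {f : ℍ → X} {x : X}
    (hT : ∀ τ, f (T • τ) = f τ)
    (h : Tendsto f (atImInfty ⊓ 𝓟 (verticalStrip (1 / 2) 1)) (𝓝 x)) :
    Tendsto f atImInfty (𝓝 x) := by
  have hTn : ∀ (n : ℤ) τ, f (T ^ n • τ) = f τ := fun n => by
    induction n with
    | zero => simp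
    | succ n ih => intro τ; rw [zpow_add_one, mul_smul, ih, hT]
    | pred n ih =>
      intro τ
      rw [zpow_sub_one, mul_smul, ih, ← hT, smul_inv_smul]
  rw [tendsto_def] at h ⊢
  intro s hs
  have h1 := h s hs
  rw [mem_inf_principal, atImInfty_mem] at h1
  obtain ⟨a, ha⟩ := h1
  rw [atImInfty_mem]
  refine ⟨max a 1, fun τ hτ => ?_⟩
  have him : (T ^ (-round τ.re) • τ).im = τ.im := ModularGroup.im_T_zpow_smul _ _
  have := ha (T ^ (-round τ.re) • τ) (him ▸ (le_max_left _ _).trans hτ)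
    ⟨?_, him ▸ (le_max_right _ _).trans hτ⟩
  · show f τ ∈ s
    rw [← hTn (-round τ.re) τ]
    exact this
  · rw [ModularGroup.re_T_zpow_smul]
    push_cast
    rw [← sub_eq_add_neg]
    exact abs_sub_round _

/-- Terms with c ≠ 0 die because |cτ + d| ≥ Im τ. The pairs (0, 1) and (0, -1) remain, each
contributing x since k is even. -/
lemma IsRowFamily.tendsto {A : CoprimePair → ℍ → ℂ} (hA : IsRowFamily A) {k : ℕ} (hk : 3 ≤ k)
    (hk2 : Even k) {x : ℂ} (hx : ∀ p : CoprimePair, p.1.1 = 0 → ∀ τ, A p τ = x) :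
    Tendsto (fun τ : ℍ => ∑' p, J p.1.1 p.1.2 τ ^ (-(k : ℤ)) * A p τ)
      (atImInfty ⊓ 𝓟 (verticalStrip (1 / 2) 1)) (𝓝 (2 * x)) := by
  have hk' : (3 : ℝ) ≤ k := by exact_mod_cast hk
  obtain ⟨u, hu, h⟩ := hA.norm_le_of_mem_verticalStrip hk (a := 1 / 2) (b := 1) one_pos
  have hlim := tendsto_tsum_of_dominated_convergence
    (𝓕 := atImInfty ⊓ 𝓟 (verticalStrip (1 / 2) 1))
    (f := fun (τ : ℍ) p => J p.1.1 p.1.2 τ ^ (-(k : ℤ)) * A p τ)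
    (g := fun p : CoprimePair => if p.1.1 = 0 then x else 0) hu (fun p => ?_) ?_
  · convert! hlim using 2
    have hp : IsCoprime (0 : ℤ) 1 := by norm_num
    have hm : IsCoprime (0 : ℤ) (-1) := by norm_num
    rw [tsum_eq_sum (s := {⟨(0, 1), hp⟩, ⟨(0, -1), hm⟩}) fun p hps => ?_]
    · rw [Finset.sum_pair (by simp)]
      simp [two_mul]
    · rw [if_neg]
      intro h0
      have h1 := p.2
      rw [h0, isCoprime_zero_left, Int.isUnit_iff] at h1
      apply hps
      rcases h1 with h1 | h1
      · simp [Subtype.ext_iff, Prod.ext_iff, h0, h1]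
      · simp [Subtype.ext_iff, Prod.ext_iff, h0, h1]
  · by_cases h0 : p.1.1 = 0
    · rw [if_pos h0]
      have h1 := p.2
      rw [h0, isCoprime_zero_left, Int.isUnit_iff] at h1
      have : ∀ τ : ℍ, J p.1.1 p.1.2 τ ^ (-(k : ℤ)) * A p τ = x := fun τ => by
        rw [hx p h0]
        rcases h1 with h1 | h1
        · simp [J, h0, h1]
        · simp [J, h0, h1, hk2.neg_one_pow]
      simp only [this]
      exact tendsto_const_nhds
    · rw [if_neg h0]
      refine Tendsto.mono_left ?_ inf_le_left
      refine squeeze_zero_norm (hA.norm_le k p) ?_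
      refine (tendsto_rpow_neg_atTop (by linarith)).comp (tendsto_atTop_mono (fun τ : ℍ => ?_)
        tendsto_comap)
      have h1 : (1 : ℝ) ≤ |(p.1.1 : ℝ)| := by exact_mod_cast Int.one_le_abs h0
      calc τ.im ≤ |(p.1.1 : ℝ)| * τ.im := le_mul_of_one_le_left τ.im_pos.le h1
        _ = |(J p.1.1 p.1.2 τ).im| := by simp [J, abs_mul, abs_of_pos τ.im_pos]
        _ ≤ _ := Complex.abs_im_le_norm _
  · exact mem_inf_of_right fun τ hτ => h τ hτ

/-- The coefficient of `ϑ₀` in the Jacobi-Eisenstein series. -/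
def eisCoeff0 (k : ℕ) (τ : ℍ) : ℂ :=
  1 / 2 * ∑' p : CoprimePair, J p.1.1 p.1.2 τ ^ (-(k : ℤ)) * rowA (cosetRep p) τ

/-- The coefficient of `ϑ₁` in the Jacobi-Eisenstein series. -/
def eisCoeff1 (k : ℕ) (τ : ℍ) : ℂ :=
  1 / 2 * ∑' p : CoprimePair, J p.1.1 p.1.2 τ ^ (-(k : ℤ)) * rowB (cosetRep p) τ

lemma jacobiEisenstein_eq {k : ℕ} (hk : 3 ≤ k) (τ : ℍ) (z : ℂ) :
    jacobiEisenstein k τ z = eisCoeff0 k τ * th0 τ z + eisCoeff1 k τ * th1 τ z := by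
  have h0 := (isRowFamily_rowA.summable hk τ).mul_right (th0 τ z)
  have h1 := (isRowFamily_rowB.summable hk τ).mul_right (th1 τ z)
  rw [jacobiEisenstein_eq_tsum, eisCoeff0, eisCoeff1, mul_assoc, mul_assoc, ← tsum_mul_right,
    ← tsum_mul_right, ← mul_add, ← h0.tsum_add h1]
  simp only [eisTerm_eq, cosetRep_one_zero, cosetRep_one_one]

lemma jacobiEisenstein_decomp {k : ℕ} (hk : 3 ≤ k) :
    ThetaDecomp (jacobiEisenstein k) (eisCoeff0 k) (eisCoeff1 k) := by
  -- The coefficients are unique, so their behaviour under T can be read off from that of the whole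
  -- series.
  have hT : ∀ τ, eisCoeff0 k (T • τ) = eisCoeff0 k τ ∧
      eisCoeff1 k (T • τ) * Complex.I = eisCoeff1 k τ := fun τ =>
    th_linearIndependent τ.2 fun z => by
      rw [← jacobiEisenstein_eq hk, ← jacobiEisenstein_T_smul, jacobiEisenstein_eq hk, coe_T_smul,
        th0_add_one, th1_add_one τ.2]
      ring
  exact {
    eq := jacobiEisenstein_eq hk
    hol0 := (isRowFamily_rowA.hol_tsum hk).const_mul _
    hol1 := (isRowFamily_rowB.hol_tsum hk).const_mul _
    T0 := fun τ => (hT τ).1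
    T1 := fun τ => by
      rw [← (hT τ).2]
      linear_combination eisCoeff1 k (T • τ) * Complex.I_mul_I }

lemma tendsto_eisCoeff0 {k : ℕ} (hk : 3 ≤ k) (hk2 : Even k) :
    Tendsto (eisCoeff0 k) atImInfty (𝓝 1) := by
  refine tendsto_atImInfty_of_strip (jacobiEisenstein_decomp hk).T0 ?_
  have h := (isRowFamily_rowA.tendsto hk hk2 (x := 1)
    fun p hp τ => (rowA_rowB_of_zero hp τ).1).const_mul (1 / 2)
  rwa [mul_one, one_div_mul_cancel two_ne_zero] at h

lemma tendsto_eisCoeff1 {k : ℕ} (hk : 3 ≤ k) (hk2 : Even k) :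
    Tendsto (eisCoeff1 k) atImInfty (𝓝 0) := by
  -- The coefficient itself is invariant under T only up to the factor -i; its norm is invariant.
  rw [tendsto_zero_iff_norm_tendsto_zero]
  refine tendsto_atImInfty_of_strip (fun τ => ?_) ?_
  · rw [(jacobiEisenstein_decomp hk).T1, norm_mul, norm_neg, Complex.norm_I, one_mul]
  · have h := ((isRowFamily_rowB.tendsto hk hk2 (x := 0)
      fun p hp τ => (rowA_rowB_of_zero hp τ).2).const_mul (1 / 2)).norm
    rwa [mul_zero, mul_zero, norm_zero] at h

/-! ### The Jacobi form `φ_{12, A₁}` and the weak Jacobi form `φ_{0, 1}` -/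

lemma tendsto_th1_zero : Tendsto (fun τ : ℍ => th1 τ 0) atImInfty (𝓝 0) := by
  obtain ⟨c, hc⟩ := exists_tendsto_th1_zero
  have h := (tendsto_ex_mul (r := 1 / 4) (by norm_num)).mul hc
  rw [zero_mul] at h
  refine h.congr fun τ => ?_
  rw [← mul_div_assoc, mul_comm, div_eq_iff (ex_ne_zero _)]
  congr 2
  push_cast
  ring

/-- Both sides lie in a one-dimensional space of modular forms and tend to 1 at i∞. -/
lemma jacobiEisenstein_zero {k : ℕ} (hk : 3 ≤ k) (hk2 : Even k)
    (hr : Module.rank ℂ (ModularForm 𝒮ℒ k) = 1) (τ : ℍ) :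
    jacobiEisenstein k τ 0 = ModularForm.E hk τ := by
  have heq : ∀ τ : ℍ, jacobiEisenstein k τ 0 =
      eisCoeff0 k τ * th0 τ 0 + eisCoeff1 k τ * th1 τ 0 := fun τ => jacobiEisenstein_eq hk τ 0
  have hdec := jacobiEisenstein_decomp hk
  have hlim : Tendsto (fun τ => jacobiEisenstein k τ 0) atImInfty (𝓝 1) := by
    have h := ((tendsto_eisCoeff0 hk hk2).mul tendsto_th0_zero).add
      ((tendsto_eisCoeff1 hk hk2).mul tendsto_th1_zero)
    rw [mul_one, mul_zero, add_zero] at h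
    exact h.congr fun τ => (heq τ).symm
  have hhol : Hol fun τ => jacobiEisenstein k τ 0 := by
    simp only [heq]
    exact (hdec.hol0.mul hol_th0_zero).add (hdec.hol1.mul hol_th1_zero)
  obtain ⟨F, hF⟩ := exists_modularForm (k := k) hhol
    (fun τ => by simpa [ex_zero] using jacobiEisenstein_S_smul k τ 0)
    (fun τ => jacobiEisenstein_T_smul k τ 0) (hlim.isBigO_one ℝ)
  have hlimE := tendsto_E hk hk2
  have hE : ModularForm.E hk ≠ 0 := fun h0 => by
    rw [h0] at hlimE
    exact zero_ne_one (tendsto_nhds_unique (tendsto_const_nhds (x := (0 : ℂ))) hlimE)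
  obtain ⟨c, hc⟩ := exists_smul_eq_of_finrank_eq_one
    (Module.rank_eq_one_iff_finrank_eq_one.mp hr) hE F
  have hc' : ∀ τ, jacobiEisenstein k τ 0 = c * ModularForm.E hk τ := fun τ => by
    rw [← hF, ← hc]
    rfl
  have hc1 : c = 1 := by
    have h := hlimE.const_mul c
    rw [mul_one] at h
    exact tendsto_nhds_unique (h.congr fun τ => (hc' τ).symm) hlim
  rw [hc', hc1, one_mul]

/-- The coefficient of `ϑ₀` in `φ_{12, A₁}`. -/
def phi12Coeff0 (τ : ℍ) : ℂ :=
  1 / 144 * (ModularForm.E₄ τ ^ 2 * eisCoeff0 4 τ - ModularForm.E₆ τ * eisCoeff0 6 τ)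

/-- The coefficient of `ϑ₁` in `φ_{12, A₁}`. -/
def phi12Coeff1 (τ : ℍ) : ℂ :=
  1 / 144 * (ModularForm.E₄ τ ^ 2 * eisCoeff1 4 τ - ModularForm.E₆ τ * eisCoeff1 6 τ)

lemma hol_modularForm {k : ℤ} (f : ModularForm 𝒮ℒ k) : Hol fun τ => f τ :=
  hol_iff.mpr f.holo'

lemma phi12A1_decomp : ThetaDecomp phi12A1 phi12Coeff0 phi12Coeff1 := by
  have h4 := jacobiEisenstein_decomp (k := 4) (by norm_num)
  have h6 := jacobiEisenstein_decomp (k := 6) (by norm_num)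
  have hE4 := hol_modularForm ModularForm.E₄
  have hE6 := hol_modularForm ModularForm.E₆
  exact {
    eq := fun τ z => by
      rw [phi12A1, h4.eq, h6.eq, phi12Coeff0, phi12Coeff1]
      ring
    hol0 := (((hE4.pow 2).mul h4.hol0).sub (hE6.mul h6.hol0)).const_mul _
    hol1 := (((hE4.pow 2).mul h4.hol1).sub (hE6.mul h6.hol1)).const_mul _
    T0 := fun τ => by
      rw [phi12Coeff0, modularForm_T_smul, modularForm_T_smul, h4.T0, h6.T0, phi12Coeff0]
    T1 := fun τ => by
      rw [phi12Coeff1, modularForm_T_smul, modularForm_T_smul, h4.T1, h6.T1, phi12Coeff1]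
      ring }

lemma phi12A1_S_smul (τ : ℍ) (z : ℂ) :
    phi12A1 (S • τ) (z / τ) = (τ : ℂ) ^ 12 * ex (z ^ 2 / τ) * phi12A1 τ z := by
  rw [phi12A1, modularForm_S_smul, modularForm_S_smul, jacobiEisenstein_S_smul,
    jacobiEisenstein_S_smul, phi12A1]
  norm_cast
  ring

lemma tendsto_phi12Coeff0 : Tendsto phi12Coeff0 atImInfty (𝓝 0) := by
  have h := (((((tendsto_E (k := 4) (by norm_num) (by decide)).pow 2).mul
    (tendsto_eisCoeff0 (k := 4) (by norm_num) (by decide))).sub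
    ((tendsto_E (k := 6) (by norm_num) (by decide)).mul
    (tendsto_eisCoeff0 (k := 6) (by norm_num) (by decide)))).const_mul (1 / 144))
  norm_num at h
  exact h.congr fun τ => by simp [phi12Coeff0]

lemma tendsto_phi12Coeff1 : Tendsto phi12Coeff1 atImInfty (𝓝 0) := by
  have h := (((((tendsto_E (k := 4) (by norm_num) (by decide)).pow 2).mul
    (tendsto_eisCoeff1 (k := 4) (by norm_num) (by decide))).sub
    ((tendsto_E (k := 6) (by norm_num) (by decide)).mul
    (tendsto_eisCoeff1 (k := 6) (by norm_num) (by decide)))).const_mul (1 / 144))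
  norm_num at h
  exact h.congr fun τ => by simp [phi12Coeff1]

/-- A 1-periodic holomorphic function vanishing at i∞ is O(q), and q = O(Δ). -/
lemma isBoundedAtImInfty_div_discriminant {f : ℍ → ℂ} (hf : Hol f) (hT : ∀ τ, f (T • τ) = f τ)
    (h : Tendsto f atImInfty (𝓝 0)) :
    IsBoundedAtImInfty fun τ => f τ / ModularForm.discriminant τ :=
  (Asymptotics.div_isBoundedUnder_of_isBigO ((isBigO_exp_of_tendsto_zero hf hT h).trans
    ModularForm.exp_isBigO_discriminant)).isBigO_one ℝ

lemma discriminant_ne_zero (τ : ℍ) : ModularForm.discriminant τ ≠ 0 :=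
  pow_ne_zero 24 (eta_ne_zero τ)

lemma phi01_eq (τ : ℍ) (z : ℂ) : phi01 τ z = phi12A1 τ z / ModularForm.discriminant τ := rfl

lemma phi01_weakJacobi : WeakJacobi 0 phi01 where
  S_smul τ z := by
    have hτ := τ.ne_zero
    rw [phi01_eq, phi12A1_S_smul, discriminant_S_smul, phi01_eq]
    have := discriminant_ne_zero τ
    norm_cast
    field_simp
  exists_decomp := by
    have h := phi12A1_decomp
    refine ⟨fun τ => phi12Coeff0 τ / ModularForm.discriminant τ,
      fun τ => phi12Coeff1 τ / ModularForm.discriminant τ, ?_, ?_, ?_⟩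
    · exact {
        eq := fun τ z => by
          rw [phi01_eq, h.eq]
          ring
        hol0 := h.hol0.div hol_discriminant discriminant_ne_zero
        hol1 := h.hol1.div hol_discriminant discriminant_ne_zero
        T0 := fun τ => by rw [h.T0, discriminant_T_smul]
        T1 := fun τ => by rw [h.T1, discriminant_T_smul, mul_div_assoc] }
    · exact isBoundedAtImInfty_div_discriminant h.hol0 h.T0 tendsto_phi12Coeff0
    -- The factor q^(1/4) makes the coefficient of ϑ₁ invariant under T, as the division by Δ
    -- requires.
    · have hlim : Tendsto (fun τ : ℍ => ex (τ / 4) * phi12Coeff1 τ) atImInfty (𝓝 0) := by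
        have h1 := (tendsto_ex_mul (r := 1 / 4) (by norm_num)).mul tendsto_phi12Coeff1
        rw [mul_zero] at h1
        refine h1.congr fun τ => ?_
        congr 2
        push_cast
        ring
      have hhol : Hol fun τ => ex (τ / 4) * phi12Coeff1 τ := by
        have h2 := (hol_ex_mul (1 / 4)).mul h.hol1
        refine h2.congr fun v _ => ?_
        simp only [one_div_mul_eq_div]
      have hb := isBoundedAtImInfty_div_discriminant hhol (fun τ => by
        rw [h.T1, coe_T_smul, add_div, ex_add, ex_quarter]
        linear_combination (-(ex (τ / 4) * phi12Coeff1 τ)) * Complex.I_mul_I) hlim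
      simpa only [mul_div_assoc] using hb

/-- At z = 0 the numerator is (E₄³ - E₆²)/144 = 1728Δ/144. -/
lemma phi01_zero (τ : ℍ) : phi01 τ 0 = 12 := by
  have h4 := jacobiEisenstein_zero (k := 4) (by norm_num) (by decide)
    ModularForm.levelOne_weight_four_rank_one τ
  have h6 := jacobiEisenstein_zero (k := 6) (by norm_num) (by decide)
    ModularForm.levelOne_weight_six_rank_one τ
  rw [phi01_eq, div_eq_iff (discriminant_ne_zero τ), ModularForm.discriminant_eq_E₄_cube_sub_E₆_sq,
    phi12A1, h4, h6]
  simp only [ModularForm.E₄, ModularForm.E₆]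
  ring

lemma phi01_weakExpansion : ∃ f, WeakExpansion phi01 1 f := by
  obtain ⟨g0, g1, h, h0, h1⟩ := phi01_weakJacobi.exists_decomp
  obtain ⟨b, f, hf, -⟩ := h.exists_weakExpansion h0 h1
  have hb : b = 1 := by
    have := phi01_weakJacobi.coeff_eq_of_weight_zero hf phi01_zero
    linear_combination this / 12
  exact ⟨f, hb ▸ hf⟩

/-! ### Jacobi forms for `N A₁`, through generators of the Jacobi group -/

/-- `f` is the family of Fourier coefficients of `φ`, indexed by the exponents of
`q` and of the `ζ_j`; its support is as large as it is for the entries of the tower. -/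
structure TowerExpansion {N : ℕ} (φ : ℍ → (Fin N → ℂ) → ℂ) (f : ℤ × (Fin N → ℤ) → ℂ) : Prop where
  hasSum : ∀ (τ : ℍ) (z : Fin N → ℂ),
    HasSum (fun i : ℤ × (Fin N → ℤ) => f i * ex (i.1 * τ + ∑ j, i.2 j * z j)) (φ τ z)
  support : ∀ i, f i ≠ 0 → 1 ≤ i.1 ∧ 4 - (N : ℤ) ≤ 4 * i.1 - ∑ j, i.2 j ^ 2

/-- Jacobi forms of weight `k` and index one for `N A₁` whose Fourier coefficients are supported
on hyperbolic norms at least `4 - N`, with a nonzero coefficient on the boundary. -/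
structure IsTowerEntry (N : ℕ) (k : ℤ) (φ : ℍ → (Fin N → ℂ) → ℂ) : Prop where
  hol : IsHolomorphic φ
  S_smul : ∀ (τ : ℍ) (z : Fin N → ℂ), φ (S • τ) (fun i => z i / τ) =
    (τ : ℂ) ^ k * ex ((∑ i, z i ^ 2) / τ) * φ τ z
  T_smul : ∀ (τ : ℍ) (z : Fin N → ℂ), φ (T • τ) z = φ τ z
  heis : ∀ (τ : ℍ) (z : Fin N → ℂ) (x y : Fin N → ℤ), φ τ (fun i => z i + x i * τ + y i) =
    ex (-∑ i, ((x i : ℂ) ^ 2 * τ + 2 * x i * z i)) * φ τ z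
  exists_expansion : ∃ f, TowerExpansion φ f
  exists_limit : ∃ b ≠ 0, Tendsto (fun τ : ℍ => ex (((N : ℂ) / 2 - 1) * τ) * φ τ fun _ => -τ / 2)
    atImInfty (𝓝 b)

/-- The elliptic variables of the factors are disjoint, so the product is a convolution in the
exponent of q alone. The lower bounds add up: (4 - N) + (-1) = 4 - (N + 1). -/
lemma TowerExpansion.mul {N : ℕ} {φ : ℍ → (Fin N → ℂ) → ℂ} {f : ℤ × (Fin N → ℤ) → ℂ}
    (h : TowerExpansion φ f) {p : ℍ → ℂ → ℂ} {b : ℂ} {g : ℤ × ℤ → ℂ} (hp : WeakExpansion p b g) :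
    TowerExpansion (fun τ (z : Fin (N + 1) → ℂ) =>
      φ τ (fun i => z i.castSucc) * p τ (z (Fin.last N)))
      fun i => ∑' n : ℤ, f (i.1 - n, fun j => i.2 j.castSucc) * g (n, i.2 (Fin.last N)) where
  hasSum τ z := by
    let e : (ℤ × (Fin (N + 1) → ℤ)) × ℤ ≃ (ℤ × (Fin N → ℤ)) × (ℤ × ℤ) := {
      toFun := fun i => ((i.1.1 - i.2, fun j => i.1.2 j.castSucc), (i.2, i.1.2 (Fin.last N)))
      invFun := fun i => ((i.1.1 + i.2.1, Fin.snoc (α := fun _ => ℤ) i.1.2 i.2.2), i.2.1)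
      left_inv := fun i => by
        refine Prod.ext (Prod.ext ?_ (funext fun j => ?_)) rfl
        · simp
        · refine Fin.lastCases ?_ (fun j => ?_) j <;> simp
      right_inv := fun i => by simp }
    have h1 := hasSum_mul_complex (h.hasSum τ fun i => z i.castSucc)
      (hp.hasSum τ (z (Fin.last N)))
    have h2 := (e.hasSum_iff.mpr h1).congr_fun
      (g := fun i => f (i.1.1 - i.2, fun j => i.1.2 j.castSucc) * g (i.2, i.1.2 (Fin.last N)) *
        ex (i.1.1 * τ + ∑ j, i.1.2 j * z j)) fun i => by
      simp only [Function.comp_apply, e, Equiv.coe_fn_mk]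
      rw [mul_mul_mul_comm, ← ex_add, Fin.sum_univ_castSucc]
      congr 2
      push_cast
      ring
    -- The inner sum runs over the part n of the q-exponent that comes from p; the total exponents
    -- stay fixed.
    refine h2.prod_fiberwise fun i => ?_
    have h3 := (h2.summable.prod_factor i).hasSum
    dsimp only at h3
    rwa [tsum_mul_right] at h3
  support i hi := by
    obtain ⟨n, hn⟩ : ∃ n : ℤ,
        f (i.1 - n, fun j => i.2 j.castSucc) * g (n, i.2 (Fin.last N)) ≠ 0 := by
      by_contra! hn
      exact hi (by simp only [hn, tsum_zero])
    have h1 := h.support _ (left_ne_zero_of_mul hn)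
    have h2 := hp.support _ (right_ne_zero_of_mul hn)
    rw [Fin.sum_univ_castSucc]
    push_cast
    constructor <;> simp only at h1 h2 <;> linarith [h1.1, h1.2, h2.1, h2.2]

/-- The new variable contributes q^(1/2) p(τ, -τ/2), with limit b ≠ 0. This raises the normalizing
exponent N/2 - 1 by 1/2 and keeps the limit nonzero. -/
lemma IsTowerEntry.mul {N : ℕ} {k l : ℤ} {φ : ℍ → (Fin N → ℂ) → ℂ} (h : IsTowerEntry N k φ)
    {p : ℍ → ℂ → ℂ} (hp : WeakJacobi l p) {b : ℂ} (hb : b ≠ 0) {g : ℤ × ℤ → ℂ}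
    (hg : WeakExpansion p b g) :
    IsTowerEntry (N + 1) (k + l) fun τ (z : Fin (N + 1) → ℂ) =>
      φ τ (fun i => z i.castSucc) * p τ (z (Fin.last N)) where
  hol := by
    obtain ⟨g0, g1, hd, -⟩ := hp.exists_decomp
    refine DifferentiableOn.fun_mul ?_ ?_
    · exact DifferentiableOn.comp (g := fun p : ℂ × (Fin N → ℂ) => φ (ofComplex p.1) p.2)
        (f := fun q : ℂ × (Fin (N + 1) → ℂ) => (q.1, fun i : Fin N => q.2 i.castSucc)) h.hol
        (by fun_prop) fun _ hq => hq
    · exact DifferentiableOn.comp (g := fun q : ℂ × ℂ => p (ofComplex q.1) q.2)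
        (f := fun q : ℂ × (Fin (N + 1) → ℂ) => (q.1, q.2 (Fin.last N))) hd.differentiableOn
        (by fun_prop) fun _ hq => hq
  S_smul τ z := by
    rw [h.S_smul τ fun i => z i.castSucc, hp.S_smul, Fin.sum_univ_castSucc, add_div, ex_add,
      zpow_add₀ τ.ne_zero]
    ring
  T_smul τ z := by
    obtain ⟨g0, g1, hd, -⟩ := hp.exists_decomp
    rw [h.T_smul, hd.T_smul]
  heis τ z x y := by
    obtain ⟨g0, g1, hd, -⟩ := hp.exists_decomp
    rw [h.heis τ (fun i => z i.castSucc) (fun i => x i.castSucc) fun i => y i.castSucc, hd.heis,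
      mul_mul_mul_comm, ← ex_add, ← neg_add, Fin.sum_univ_castSucc]
  exists_expansion := by
    obtain ⟨f, hf⟩ := h.exists_expansion
    exact ⟨_, hf.mul hg⟩
  exists_limit := by
    obtain ⟨c, hc, hlim⟩ := h.exists_limit
    refine ⟨c * b, mul_ne_zero hc hb, (hlim.mul hg.tendsto_neg_half).congr fun τ => ?_⟩
    rw [mul_mul_mul_comm, ← ex_add]
    congr 2
    push_cast
    ring

lemma isTowerEntry_discriminant :
    IsTowerEntry 0 12 fun τ _ => ModularForm.discriminant τ where
  hol := DifferentiableOn.comp (f := fun q : ℂ × (Fin 0 → ℂ) => q.1) hol_discriminant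
    (by fun_prop) fun _ hq => hq
  S_smul τ z := by
    rw [discriminant_S_smul]
    simp [ex_zero]
  T_smul τ z := discriminant_T_smul τ
  heis τ z x y := by simp [ex_zero]
  exists_expansion := by
    have hlim : Tendsto (fun τ : ℍ => ModularForm.discriminant τ) atImInfty (𝓝 0) := by
      have h := (tendsto_ex_mul (r := 1) one_pos).mul tendsto_discriminant_div
      rw [zero_mul] at h
      refine h.congr fun τ => ?_
      rw [ofReal_one, one_mul, mul_div_cancel₀ _ (ex_ne_zero _)]
    obtain ⟨a, ha⟩ := exists_hasSum_of_bounded hol_discriminant discriminant_T_smul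
      (hlim.isBigO_one ℝ)
    have ha0 : a 0 = 0 := tendsto_nhds_unique (ThetaDecomp.tendsto_coeff_zero ha) hlim
    have hinj : Function.Injective fun m : ℕ => ((m : ℤ), (default : Fin 0 → ℤ)) := fun m n h => by
      simpa using h
    refine ⟨Function.extend _ a 0, fun τ z => hasSum_extend_mul hinj ?_, fun i hi => ?_⟩
    · simpa using ha τ
    · obtain ⟨m, rfl⟩ := exists_of_extend_ne_zero hi
      rw [hinj.extend_apply] at hi
      have hm : 1 ≤ m := Nat.one_le_iff_ne_zero.mpr fun h0 => hi (h0 ▸ ha0)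
      have hm : (1 : ℤ) ≤ m := by exact_mod_cast hm
      simp
      omega
  exists_limit := by
    refine ⟨1, one_ne_zero, tendsto_discriminant_div.congr fun τ => ?_⟩
    rw [div_eq_mul_inv, mul_comm, ← ex_neg]
    congr 2
    push_cast
    ring

/-! ### From the generators to the full Jacobi group -/

lemma bil_NA1 {N : ℕ} {R : Type*} [CommRing R] (v w : Fin N → R) :
    (NA1 N).bil v w = 2 * ∑ i, v i * w i := by
  simp only [EvenLattice.bil, NA1, Matrix.diagonal_apply, Finset.mul_sum]
  refine Finset.sum_congr rfl fun i _ => ?_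
  rw [Finset.sum_eq_single i (fun j _ hj => by simp [hj.symm]) (by simp)]
  simp
  ring

/-- Covariance of index one and weight `k` under `γ ∈ SL(2, ℤ)`. -/
def IsCovariant {N : ℕ} (k : ℤ) (φ : ℍ → (Fin N → ℂ) → ℂ) (γ : SL(2, ℤ)) : Prop :=
  ∀ (τ : ℍ) (z : Fin N → ℂ), φ (γ • τ) (fun i => z i / J (γ 1 0) (γ 1 1) τ) =
    J (γ 1 0) (γ 1 1) τ ^ k * ex (γ 1 0 * (∑ i, z i ^ 2) / J (γ 1 0) (γ 1 1) τ) * φ τ z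

lemma isCovariant_one {N : ℕ} (k : ℤ) (φ : ℍ → (Fin N → ℂ) → ℂ) : IsCovariant k φ 1 :=
  fun τ z => by simp [J, ex_zero]

lemma sum_div_sq {N : ℕ} (z : Fin N → ℂ) (j : ℂ) :
    ∑ i, (z i / j) ^ 2 = (∑ i, z i ^ 2) / j ^ 2 := by
  simp only [div_pow, Finset.sum_div]

lemma IsCovariant.mul {N : ℕ} {k : ℤ} {φ : ℍ → (Fin N → ℂ) → ℂ} {γ δ : SL(2, ℤ)}
    (hγ : IsCovariant k φ γ) (hδ : IsCovariant k φ δ) : IsCovariant k φ (γ * δ) := fun τ z => by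
  have h := hγ (δ • τ) fun i => z i / J (δ 1 0) (δ 1 1) τ
  rw [hδ, sum_div_sq] at h
  rw [J_mul, mul_smul, index_cocycle, ex_add, mul_zpow]
  simp only [← div_div, div_right_comm _ (J (γ 1 0) _ _)]
  rw [h]
  ring

lemma IsCovariant.inv {N : ℕ} {k : ℤ} {φ : ℍ → (Fin N → ℂ) → ℂ} {γ : SL(2, ℤ)}
    (hγ : IsCovariant k φ γ) : IsCovariant k φ γ⁻¹ := fun τ z => by
  have hJ := J_mul γ γ⁻¹ τ
  have hc := index_cocycle γ γ⁻¹ τ (∑ i, z i ^ 2)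
  rw [mul_inv_cancel] at hJ hc
  have h1 : J ((1 : SL(2, ℤ)) 1 0) ((1 : SL(2, ℤ)) 1 1) τ = 1 := by simp [J]
  have h10 : (((1 : SL(2, ℤ)) 1 0 : ℤ) : ℂ) = 0 := by simp
  rw [h1] at hJ
  rw [h10, zero_mul, zero_div] at hc
  have h := hγ (γ⁻¹ • τ) fun i => z i / J (γ⁻¹ 1 0) (γ⁻¹ 1 1) τ
  have hz : (fun i => z i / J (γ⁻¹ 1 0) (γ⁻¹ 1 1) τ / J (γ 1 0) (γ 1 1) (γ⁻¹ • τ : ℍ)) = z := by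
    funext i
    rw [div_div, mul_comm, ← hJ, div_one]
  rw [sum_div_sq, hz, smul_inv_smul] at h
  rw [h, ← mul_assoc, mul_mul_mul_comm, ← mul_zpow, mul_comm (J _ _ (τ : ℂ)), ← hJ, one_zpow,
    ← ex_add, ← hc, ex_zero, one_mul, one_mul]

namespace IsTowerEntry

variable {N : ℕ} {k : ℤ} {φ : ℍ → (Fin N → ℂ) → ℂ}

lemma isCovariant (h : IsTowerEntry N k φ) (γ : SL(2, ℤ)) : IsCovariant k φ γ := by
  have hγ : γ ∈ Subgroup.closure {S, T} := by
    rw [SpecialLinearGroup.SL2Z_generators]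
    trivial
  induction hγ using Subgroup.closure_induction with
  | mem γ hγ =>
    rcases hγ with rfl | rfl
    · intro τ z
      have h0 : S 1 0 = 1 := rfl
      have h1 : S 1 1 = 0 := rfl
      simpa [J, h0, h1] using h.S_smul τ z
    · intro τ z
      have h0 : T 1 0 = 0 := rfl
      have h1 : T 1 1 = 1 := rfl
      simpa [J, h0, h1, ex_zero] using h.T_smul τ z
  | one => exact isCovariant_one k φ
  | mul γ δ _ _ h1 h2 => exact h1.mul h2
  | inv γ _ h1 => exact h1.inv

lemma slashSL_eq (h : IsTowerEntry N k φ) (A : SL(2, ℤ)) (τ : ℍ) (z : Fin N → ℂ) :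
    slashSL (NA1 N) k 1 φ A τ z = φ τ z := by
  have hJ : J (A 1 0) (A 1 1) τ ≠ 0 := J_ne_zero (isCoprime_bottom_row A) τ
  have hc := h.isCovariant A τ z
  rw [slashSL, bil_NA1]
  change J (A 1 0) (A 1 1) τ ^ (-k) * Complex.exp (-(π * Complex.I * (1 : ℚ) *
    (A 1 0 * (2 * ∑ i, z i * z i) / J (A 1 0) (A 1 1) τ))) *
    φ (A • τ) (fun i => z i / J (A 1 0) (A 1 1) τ) = _
  have he : Complex.exp (-(π * Complex.I * (1 : ℚ) *
      (A 1 0 * (2 * ∑ i, z i * z i) / J (A 1 0) (A 1 1) τ))) =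
      (ex (A 1 0 * (∑ i, z i ^ 2) / J (A 1 0) (A 1 1) τ))⁻¹ := by
    rw [← ex_neg, ex]
    simp only [pow_two]
    congr 1
    push_cast
    ring
  have h2 := ex_ne_zero (A 1 0 * (∑ i, z i ^ 2) / J (A 1 0) (A 1 1) τ)
  have h3 := zpow_ne_zero k hJ
  rw [he, hc, zpow_neg]
  generalize ex (A 1 0 * (∑ i, z i ^ 2) / J (A 1 0) (A 1 1) τ) = E at h2 ⊢
  field_simp

lemma slashHeis_eq (h : IsTowerEntry N k φ) {x y : Fin N → ℤ} {r : ℚ}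
    (hr : ∃ b : ℤ, r + (((NA1 N).bil x y : ℤ) : ℚ) / 2 = b) (τ : ℍ) (z : Fin N → ℂ) :
    slashHeis (NA1 N) 1 φ x y r τ z = φ τ z := by
  obtain ⟨b, hb⟩ := hr
  have hb' : (r : ℂ) + (((NA1 N).bil x y : ℤ) : ℂ) / 2 = b := by
    exact_mod_cast congrArg (Rat.cast (K := ℂ)) hb
  rw [slashHeis, h.heis, ← mul_assoc]
  have he : Complex.exp (2 * π * Complex.I * (1 : ℚ) * (((NA1 N).bil x x : ℤ) / 2 * τ +
      (NA1 N).bil (fun i => (x i : ℂ)) z + ((NA1 N).bil x y : ℤ) / 2 + r)) =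
      ex (∑ i, ((x i : ℂ) ^ 2 * τ + 2 * x i * z i)) := by
    -- The central part r + (x, y)/2 is an integer, so it does not affect the exponential.
    rw [← ex_add_intCast _ b, ← hb', ex, bil_NA1 (fun i => (x i : ℂ)), bil_NA1 x x]
    congr 1
    rw [Finset.sum_add_distrib, ← Finset.sum_mul]
    simp only [mul_assoc (2 : ℂ), ← Finset.mul_sum]
    push_cast
    simp only [pow_two]
    ring
  rw [he, ex_neg, mul_inv_cancel₀ (ex_ne_zero _), one_mul]

lemma isJacobiInvariant (h : IsTowerEntry N k φ) : IsJacobiInvariant (NA1 N) k 1 φ :=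
  ⟨h.slashSL_eq, fun _ _ _ _ hr τ z => h.slashHeis_eq hr τ z⟩

end IsTowerEntry

/-! ### Expansions over the dual lattice and the cusp condition -/

/-- The dual lattice of `N A₁` is `(ℤ / 2) ^ N`. -/
def dualEquiv (N : ℕ) : (Fin N → ℤ) ≃ (NA1 N).dual :=
  Equiv.ofBijective (fun r => ⟨fun i => r i / 2, fun x => ⟨∑ i, r i * x i, by
    rw [bil_NA1, Finset.mul_sum]
    push_cast
    exact Finset.sum_congr rfl fun i _ => by ring⟩⟩) <| by
    constructor
    · intro r s hrs
      funext i
      have h := congrFun (congrArg Subtype.val hrs) i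
      simpa using h
    · rintro ⟨l, hl⟩
      -- Pairing l with the i-th basis vector gives 2 l_i, which is therefore an integer.
      choose r hr using fun i => hl (Pi.single i 1)
      refine ⟨r, Subtype.ext (funext fun i => ?_)⟩
      have h := hr i
      rw [bil_NA1, Finset.sum_eq_single i (fun j _ hj => by simp [hj]) (by simp)] at h
      simp only [Pi.single_eq_same] at h
      push_cast at h
      show (r i : ℝ) / 2 = l i
      linarith

lemma dualEquiv_apply {N : ℕ} (r : Fin N → ℤ) (i : Fin N) :
    (dualEquiv N r : Fin N → ℝ) i = r i / 2 := rfl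

lemma TowerExpansion.hasFourierExpansion {N : ℕ} {φ : ℍ → (Fin N → ℂ) → ℂ}
    {f : ℤ × (Fin N → ℤ) → ℂ} (h : TowerExpansion φ f) :
    HasFourierExpansion (NA1 N) φ fun n l => f (n, (dualEquiv N).symm l) := fun τ z => by
  refine (((Equiv.refl ℤ).prodCongr (dualEquiv N)).hasSum_iff).mp
    ((h.hasSum τ z).congr_fun fun i => ?_)
  simp only [Function.comp_apply, Equiv.prodCongr_apply, Prod.map, Equiv.refl_apply,
    Equiv.symm_apply_apply, ex, bil_NA1, dualEquiv_apply]
  congr 3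
  rw [Finset.mul_sum]
  congr 1
  refine Finset.sum_congr rfl fun j _ => ?_
  push_cast
  ring

/-- For l = r/2 one has (l, l) = ∑ r_j²/2, so 2n - (l, l) is half of 4n - ∑ r_j². -/
lemma TowerExpansion.hyperbolic_norm {N : ℕ} {φ : ℍ → (Fin N → ℂ) → ℂ}
    {f : ℤ × (Fin N → ℤ) → ℂ} (h : TowerExpansion φ f) {n : ℤ} {l : (NA1 N).dual}
    (hf : f (n, (dualEquiv N).symm l) ≠ 0) :
    0 ≤ n ∧ (4 - N : ℝ) / 2 ≤ 2 * (n : ℝ) * (1 : ℚ) - (NA1 N).bil (l : Fin N → ℝ) l := by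
  obtain ⟨r, rfl⟩ := (dualEquiv N).surjective l
  rw [Equiv.symm_apply_apply] at hf
  obtain ⟨h1, h2⟩ := h.support _ hf
  refine ⟨by simp only at h1; omega, ?_⟩
  have h2 : (4 : ℝ) - N ≤ 4 * n - ∑ j, (r j : ℝ) ^ 2 := by exact_mod_cast h2
  have h3 : ∑ i, (r i / 2 : ℝ) * (r i / 2) = (∑ j, (r j : ℝ) ^ 2) / 4 := by
    rw [Finset.sum_div]
    exact Finset.sum_congr rfl fun i _ => by ring
  simp only [bil_NA1, dualEquiv_apply, h3]
  push_cast
  linarith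

namespace IsTowerEntry

variable {N : ℕ} {k : ℤ} {φ : ℍ → (Fin N → ℂ) → ℂ}

lemma isJacobiForm (h : IsTowerEntry N k φ) (hN : N ≤ 4) : IsJacobiForm (NA1 N) k 1 φ := by
  obtain ⟨f, hf⟩ := h.exists_expansion
  have hN : (N : ℝ) ≤ 4 := by exact_mod_cast hN
  refine ⟨h.hol, h.isJacobiInvariant, _, hf.hasFourierExpansion, fun n l hnl => ?_⟩
  obtain ⟨h1, h2⟩ := hf.hyperbolic_norm hnl
  exact ⟨h1, le_trans (by linarith) h2⟩

lemma isJacobiCuspForm (h : IsTowerEntry N k φ) (hN : N ≤ 3) :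
    IsJacobiCuspForm (NA1 N) k 1 φ := by
  obtain ⟨f, hf⟩ := h.exists_expansion
  have hN : (N : ℝ) ≤ 3 := by exact_mod_cast hN
  refine ⟨h.hol, h.isJacobiInvariant, _, hf.hasFourierExpansion, fun n l hnl => ?_⟩
  obtain ⟨h1, h2⟩ := hf.hyperbolic_norm hnl
  exact ⟨h1, lt_of_lt_of_le (by linarith) h2⟩

/-- At z_j = -τ/2, after multiplication by q, the term (n, l) has exponent n + 1 - ∑ l_j.
Cuspidality means n > ∑ l_j², so this exponent exceeds ∑ (l_j - 1/2)² ≥ 0. Every term would then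
vanish at i∞, against the nonzero limit. The argument applies to any Fourier expansion of the form,
so uniqueness of coefficients is not needed. -/
lemma not_isJacobiCuspForm (h : IsTowerEntry N k φ) (hN : N = 4) :
    ¬ IsJacobiCuspForm (NA1 N) k 1 φ := by
  subst hN
  rintro ⟨-, -, f, hf, hsupp⟩
  obtain ⟨b, hb, hlim⟩ := h.exists_limit
  let r : ℤ × (NA1 4).dual → ℝ := fun p => p.1 + 1 - ∑ i, (p.2 : Fin 4 → ℝ) i
  have hr : ∀ p, f p.1 p.2 ≠ 0 → 0 < r p := fun p hp => by
    have h1 := (hsupp p.1 p.2 hp).2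
    rw [bil_NA1] at h1
    simp only [Fin.sum_univ_four, Rat.cast_one, r] at h1 ⊢
    nlinarith [sq_nonneg ((p.2 : Fin 4 → ℝ) 0 - 1 / 2), sq_nonneg ((p.2 : Fin 4 → ℝ) 1 - 1 / 2),
      sq_nonneg ((p.2 : Fin 4 → ℝ) 2 - 1 / 2), sq_nonneg ((p.2 : Fin 4 → ℝ) 3 - 1 / 2)]
  have hlim' := tendsto_atImInfty_of_hasSum (c := fun p : ℤ × (NA1 4).dual => f p.1 p.2) (r := r)
    (F := fun τ : ℍ => ex ((((4 : ℕ) : ℂ) / 2 - 1) * τ) * φ τ fun _ => -τ / 2)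
    (fun p hp => (hr p hp).le) fun τ => ((hf τ fun _ => -τ / 2).mul_left _).congr_fun fun p => by
      rw [mul_left_comm]
      congr 1
      rw [bil_NA1, ex, ex, ← Complex.exp_add, ← Finset.sum_mul]
      congr 1
      simp only [r]
      push_cast
      ring
  refine hb (tendsto_nhds_unique hlim ?_)
  convert! hlim'
  refine ((tsum_congr fun p => ?_).trans tsum_zero).symm
  split_ifs with h0
  · by_contra hp
    exact (hr p hp).ne' h0
  · rfl

end IsTowerEntry

/-! ### The tower -/

lemma columnTop_eq (m : ℕ) (τ : ℍ) (z : Fin m → ℂ) :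
    columnTop m τ z = (ModularForm.eta τ ^ (12 - 3 * (m : ℤ)) * ∏ j, theta τ (z j)) ^ 2 := by
  cases m with
  | zero =>
    simp only [columnTop, Finset.univ_eq_empty, Finset.prod_empty, mul_one]
    rw [← zpow_natCast, ← zpow_natCast, ← zpow_mul]
    rfl
  | succ m => rfl

/-- Passing from m to m + 1 multiplies the base of the square by ϑ/η³, hence the form by ϑ²/η⁶. -/
lemma columnTop_succ (m : ℕ) (τ : ℍ) (z : Fin (m + 1) → ℂ) :
    columnTop (m + 1) τ z =
      columnTop m τ (fun i => z i.castSucc) * phiNegTwo τ (z (Fin.last m)) := by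
  have h := eta_ne_zero τ
  rw [columnTop_eq, columnTop_eq, Fin.prod_univ_castSucc, phiNegTwo,
    show (12 - 3 * (m : ℤ)) = 12 - 3 * ((m + 1 : ℕ) : ℤ) + 3 by push_cast; ring,
    zpow_add₀ h, zpow_ofNat]
  field_simp

lemma columnTop_isTowerEntry (m : ℕ) : IsTowerEntry m (12 - 2 * (m : ℤ)) (columnTop m) := by
  induction m with
  | zero => exact isTowerEntry_discriminant
  | succ m ih =>
    obtain ⟨f, hf⟩ := phiNegTwo_weakExpansion
    have h := ih.mul phiNegTwo_weakJacobi one_ne_zero hf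
    rw [show (12 - 2 * ((m + 1 : ℕ) : ℤ)) = 12 - 2 * (m : ℤ) + -2 by push_cast; ring]
    rwa [funext fun τ => funext fun z => columnTop_succ m τ z]

lemma towerForm_isTowerEntry (m d : ℕ) :
    IsTowerEntry (m + d) (12 - 2 * (m : ℤ)) (towerForm m d) := by
  induction d with
  | zero => exact columnTop_isTowerEntry m
  | succ d ih =>
    obtain ⟨f, hf⟩ := phi01_weakExpansion
    have h := ih.mul phi01_weakJacobi one_ne_zero hf
    rwa [add_zero] at h

/-- Since φ_{0,1}(τ, 0) = 12, the multiple is 1/12. -/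
lemma isPullback_tensorPhi01 {N : ℕ} (φ : ℍ → (Fin N → ℂ) → ℂ) :
    IsPullback (tensorPhi01 φ) φ := by
  refine ⟨1 / 12, by norm_num, fun τ z => ?_⟩
  simp only [tensorPhi01, appendCoord, Fin.snoc_castSucc, Fin.snoc_last, phi01_zero]
  ring

/-- Only the factor ϑ²/η⁶ depends on the last variable, and its second derivative at 0 is the
constant -8π². -/
lemma isQuasiPullback_columnTop (m : ℕ) : IsQuasiPullback (columnTop (m + 1)) (columnTop m) := by
  obtain ⟨f, hf⟩ := phiNegTwo_weakExpansion
  have hπ : (π : ℂ) ≠ 0 := by exact_mod_cast Real.pi_ne_zero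
  refine ⟨-(8 * (π : ℂ) ^ 2)⁻¹, by simp [hπ], fun τ z => ?_⟩
  have h2 : iteratedDeriv 2 (phiNegTwo τ) 0 = -(8 * (π : ℂ) ^ 2) := by
    rw [iteratedDeriv_succ, iteratedDeriv_one,
      phiNegTwo_weakJacobi.second_deriv_eq_of_weight_neg_two hf phiNegTwo_zero τ, mul_one]
  simp only [columnTop_succ, appendCoord, Fin.snoc_castSucc, Fin.snoc_last]
  rw [iteratedDeriv_const_mul_field, h2]
  field_simp

lemma towerForm_zero_one (τ : ℍ) (z : Fin 1 → ℂ) : towerForm 0 1 τ z = phi12A1 τ (z 0) := by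
  show ModularForm.eta τ ^ 24 * (phi12A1 τ (z 0) / ModularForm.eta τ ^ 24) = _
  exact mul_div_cancel₀ _ (pow_ne_zero 24 (eta_ne_zero τ))

end JacobiTower

end

theorem mainTheorem4 :
    -- the apex is an elliptic cusp form of weight 12
    (∃ f : CuspForm 𝒮ℒ 12, ∀ τ : ℍ, f τ = ModularForm.eta τ ^ 24) ∧
    -- weights, lattices and index: all entries are holomorphic Jacobi forms
    (∀ m d : ℕ, m + d ≤ 4 →
      JacobiTower.IsJacobiForm (JacobiTower.NA1 (m + d)) (12 - 2 * (m : ℤ)) 1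
        (JacobiTower.towerForm m d)) ∧
    -- all entries above the last row are cusp forms
    (∀ m d : ℕ, m + d ≤ 3 →
      JacobiTower.IsJacobiCuspForm (JacobiTower.NA1 (m + d)) (12 - 2 * (m : ℤ)) 1
        (JacobiTower.towerForm m d)) ∧
    -- the entries of the last row are not
    (∀ m d : ℕ, m + d = 4 →
      ¬ JacobiTower.IsJacobiCuspForm (JacobiTower.NA1 (m + d)) (12 - 2 * (m : ℤ)) 1
        (JacobiTower.towerForm m d)) ∧
    -- the vertical arrows
    (∀ m d : ℕ, m + d ≤ 3 →
      JacobiTower.IsPullback (JacobiTower.towerForm m (d + 1)) (JacobiTower.towerForm m d)) ∧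
    -- the dashed diagonal arrows
    (∀ m : ℕ, m ≤ 3 →
      JacobiTower.IsQuasiPullback (JacobiTower.columnTop (m + 1)) (JacobiTower.columnTop m)) ∧
    -- the entry of weight 12 for `A₁` is the classical Jacobi cusp form
    (∀ (τ : ℍ) (z : Fin 1 → ℂ),
      JacobiTower.towerForm 0 1 τ z = JacobiTower.phi12A1 τ (z 0)) := by
  exact ⟨⟨CuspForm.discriminant, fun _ => rfl⟩,
    fun m d h => (JacobiTower.towerForm_isTowerEntry m d).isJacobiForm h,
    fun m d h => (JacobiTower.towerForm_isTowerEntry m d).isJacobiCuspForm h,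
    fun m d h => (JacobiTower.towerForm_isTowerEntry m d).not_isJacobiCuspForm h,
    fun m d _ => JacobiTower.isPullback_tensorPhi01 (JacobiTower.towerForm m d),
    fun m _ => JacobiTower.isQuasiPullback_columnTop m,
    JacobiTower.towerForm_zero_one⟩
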